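/- Let $K$ be a number field with ring of integers $\mathfrak{o}$, and let $V$ be a quadratic space of dimension $2$ over $K$, that is, a $2$-dimensional $K$-vector space with a non-degenerate symmetric bilinear form $B$. Assume that $\det(V)\notin-(K^\times)^2$, where $\det(V)$ is the determinant of the Gram matrix of $B$ in a basis of $V$ (well defined up to $(K^\times)^2$). Let $L$ be a lattice in $V$ (a finitely generated $\mathfrak{o}$-submodule spanning $V$ over $K$), let $\nu\in V$, and let $X=L+\nu$. Let $\mathfrak{M}_X=\{a\in\mathfrak{o}: a\nu\in L\}$. For a quadratic space $W$ over a field, $O^+(W)$ denotes the group of linear automorphisms of $W$ of determinant $1$ preserving the bilinear form; for $Y\subseteq W$, $O^+(Y)$ denotes the stabilizer of $Y$ in $O^+(W)$, and the proper class of $Y$ is its orbit under $O^+(W)$. For a place $\mathfrak{p}$ of $K$, let $V_{\mathfrak{p}}=V\otimes_K K_{\mathfrak{p}}$ with the extended bilinear form, let $L_{\mathfrak{p}}$ be the $\mathfrak{o}_{\mathfrak{p}}$-submodule of $V_{\mathfrak{p}}$ generated by $L$ (with $\mathfrak{o}_{\mathfrak{p}}=K_{\mathfrak{p}}$ if $\mathfrak{p}$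 is archimedean), and let $X_{\mathfrak{p}}=L_{\mathfrak{p}}+\nu$. The proper genus of $X$ is the set of all shifted lattices $Y=M+\mu$ in $V$ (with $M$ a lattice in $V$ and $\mu\in V$) such that $Y_{\mathfrak{p}}$ lies in the proper class of $X_{\mathfrak{p}}$ for every place $\mathfrak{p}$ of $K$, and $h^+(X)$ is the number of proper classes in the proper genus of $X$; $h^+(L)$ is the case $\nu=0$. Then $h^+(X)$ and $h^+(L)$ are finite, $O^+(X)$ is a subgroup of finite index in $O^+(L)$, $O^+(X_{\mathfrak{p}})$ is a subgroup of finite index in $O^+(L_{\mathfrak{p}})$ for every finite place $\mathfrak{p}$, only finitely many primes $\mathfrak{p}$ divide $\mathfrak{M}_X$, and $$h^+(X)=\frac{h^+(L)}{[O^+(L):O^+(X)]}\prod_{\mathfrak{p}\mid\mathfrak{M}_X}[O^+(L_{\mathfrak{p}}):O^+(X_{\mathfrak{p}})].$$ -/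

import Mathlib

open scoped TensorProduct Pointwise NumberField
open IsDedekindDomain

namespace ShiftedLattice

section Orthogonal

variable {F W : Type*} [Field F] [AddCommGroup W] [Module F W]

/-- The proper orthogonal group `O⁺(W)` of a space `W` with bilinear form `B`:
the linear automorphisms of determinant one which preserve `B`. -/
def properOrthogonalGroup (B : LinearMap.BilinForm F W) : Subgroup (W ≃ₗ[F] W) where
  carrier := {σ | (∀ x y : W, B (σ x) (σ y) = B x y) ∧ LinearMap.det (σ : W →ₗ[F] W) = 1}
  one_mem' := ⟨fun _ _ => rfl, LinearMap.det_id⟩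
  mul_mem' := by
    rintro σ τ ⟨h₁, h₂⟩ ⟨h₃, h₄⟩
    refine ⟨fun x y => by simp [LinearEquiv.mul_apply, h₁, h₃], ?_⟩
    have : ((σ * τ : W ≃ₗ[F] W) : W →ₗ[F] W) = (σ : W →ₗ[F] W) ∘ₗ (τ : W →ₗ[F] W) := rfl
    rw [this, LinearMap.det_comp, h₂, h₄, one_mul]
  inv_mem' := by
    rintro σ ⟨h₁, h₂⟩
    refine ⟨fun x y => ?_, ?_⟩
    · have hx : ∀ z, σ (σ⁻¹ z) = z := fun z => σ.apply_symm_apply z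
      rw [← h₁, hx, hx]
    · have h := LinearEquiv.det_symm_mul_det σ
      rw [h₂, mul_one] at h
      exact h

/-- The stabilizer `O⁺(X)` of a subset `X` of `W` under the action of `O⁺(W)`. -/
def properStabilizer (B : LinearMap.BilinForm F W) (X : Set W) : Subgroup (W ≃ₗ[F] W) :=
  properOrthogonalGroup B ⊓ MulAction.stabilizer (W ≃ₗ[F] W) X

/-- The proper class of a subset `X` of `W`: its orbit under the action of `O⁺(W)`. -/
def properClass (B : LinearMap.BilinForm F W) (X : Set W) : Set (Set W) :=
  MulAction.orbit (properOrthogonalGroup B) X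

end Orthogonal

section Localization

variable {K V : Type*} [Field K] [AddCommGroup V] [Module K V] [Module (𝓞 K) V]

/-- An `𝓞 K`-lattice in `V`: a finitely generated `𝓞 K`-submodule which spans `V` over `K`. -/
def IsLattice (K : Type*) {V : Type*} [Field K] [AddCommGroup V] [Module K V] [Module (𝓞 K) V]
    (L : Submodule (𝓞 K) V) : Prop :=
  L.FG ∧ Submodule.span K (L : Set V) = ⊤

/-- The subset `L + ν` of `V`. -/
def shift (L : Submodule (𝓞 K) V) (ν : V) : Set V := {x | ∃ l ∈ L, x = l + ν}

/-- The conductor ideal of `L + ν`: all `a` in `𝓞 K` with `a ν ∈ L`. -/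
def conductor (L : Submodule (𝓞 K) V) (ν : V) : Ideal (𝓞 K) where
  carrier := {a | a • ν ∈ L}
  zero_mem' := by simp
  add_mem' := by
    intro a b ha hb
    simpa [add_smul] using L.add_mem ha hb
  smul_mem' := by
    intro c a ha
    simpa [mul_smul] using L.smul_mem c ha

/-- For a field extension `F` of `K` and a subring `R` of `F`, the subset `L_R + 1 ⊗ ν` of
`F ⊗ V`, where `L_R` is the `R`-submodule of `F ⊗ V` generated by the image of `L`. -/
def localShift {F : Type*} [Field F] [Algebra K F] (R : Subring F)
    (L : Submodule (𝓞 K) V) (ν : V) : Set (F ⊗[K] V) :=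
  {x | ∃ l ∈ Submodule.span R ((fun w : V => (1 : F) ⊗ₜ[K] w) '' (L : Set V)),
    x = l + (1 : F) ⊗ₜ[K] ν}

variable [NumberField K]

/-- The localization of `L + ν` at a finite place `p`, a subset of `V_p = K_p ⊗ V`. -/
def finiteLocalization (p : HeightOneSpectrum (𝓞 K)) (L : Submodule (𝓞 K) V) (ν : V) :
    Set (p.adicCompletion K ⊗[K] V) :=
  localShift (p.adicCompletionIntegers K).toSubring L ν

/-- The localization of `L + ν` at an archimedean place `p`, where the ring of integers is by
convention the whole field `K_p`. -/
def infiniteLocalization (p : NumberField.InfinitePlace K) (L : Submodule (𝓞 K) V) (ν : V) :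
    Set (p.Completion ⊗[K] V) :=
  localShift (⊤ : Subring p.Completion) L ν

/-- The proper genus of the shifted lattice `L + ν`: the shifted lattices `M + μ` in `V` whose
localization at every place of `K` is in the proper class of the localization of `L + ν`. -/
def properGenus (B : LinearMap.BilinForm K V) (L : Submodule (𝓞 K) V) (ν : V) : Set (Set V) :=
  {Y | ∃ (M : Submodule (𝓞 K) V) (μ : V), IsLattice K M ∧ Y = shift M μ ∧
    (∀ p : HeightOneSpectrum (𝓞 K), finiteLocalization p M μ ∈
      properClass (B.baseChange (p.adicCompletion K)) (finiteLocalization p L ν)) ∧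
    (∀ p : NumberField.InfinitePlace K, infiniteLocalization p M μ ∈
      properClass (B.baseChange p.Completion) (infiniteLocalization p L ν))}

/-- The set of proper classes contained in the proper genus of `L + ν`. -/
def properClasses (B : LinearMap.BilinForm K V) (L : Submodule (𝓞 K) V) (ν : V) :
    Set (Set (Set V)) :=
  properClass B '' properGenus B L ν

/-- The proper class number `h⁺(L + ν)`, the number of proper classes in the proper genus. -/
noncomputable def properClassNumber (B : LinearMap.BilinForm K V) (L : Submodule (𝓞 K) V)
    (ν : V) : ℕ :=
  (properClasses B L ν).ncard

/-- The group index `[O⁺(L) : O⁺(L + ν)]`. -/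
noncomputable def globalIndex (B : LinearMap.BilinForm K V) (L : Submodule (𝓞 K) V)
    (ν : V) : ℕ :=
  (properStabilizer B (shift L ν)).relIndex (properStabilizer B (L : Set V))

/-- The local group index `[O⁺(L_p) : O⁺(L_p + ν)]` at a finite place `p`. -/
noncomputable def localIndex (B : LinearMap.BilinForm K V) (L : Submodule (𝓞 K) V) (ν : V)
    (p : HeightOneSpectrum (𝓞 K)) : ℕ :=
  (properStabilizer (B.baseChange (p.adicCompletion K)) (finiteLocalization p L ν)).relIndex
    (properStabilizer (B.baseChange (p.adicCompletion K)) (finiteLocalization p L 0))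

end Localization

end ShiftedLattice

/-! In dimension 2 the proper orthogonal groups of V and of all V_p are abelian, and the formula is
a count of cosets that this makes possible.

Choose a representative M in every proper class of the genus of L, with local isometries ρ_p taking
L_p to M_p. A shifted lattice M + μ lies in the genus of X exactly when, at every p, μ is congruent
mod M_p to ρ_p u_p ν for some u_p in O⁺(L_p). Away from the conductor ν lies in L_p, so this only
says μ ∈ M_p; hence only the finitely many p dividing the conductor matter, and by strong
approximation every family u = (u_p) over these places occurs (`IsTwist`). Global isometries commute
with ρ_p, so O⁺(M) = O⁺(L), and u, u' give the same class over M iff u⁻¹u' lies in the subgroup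
generated by the diagonal image of O⁺(L) and by ∏ O⁺(X_p) (`IsGenusFrame.sub_mem_iff`,
`mem_classSubgroup`). This subgroup does not depend on M, so h⁺(X) is h⁺(L) times its index in ∏
O⁺(L_p) (`natCard_properClasses`). Multiplicativity of indices turns that index into the quotient in
the formula (`globalIndex_mul_index_classSubgroup`).

Finiteness of h⁺(L) uses that E = K(√-det V) is a field acting on V, which becomes a line over E.
One d in 𝓞 K satisfies d·𝓞_E·M ⊆ M for all M in the genus, so finiteness of the class group of E
leaves finitely many M up to Eˣ (`exists_finite_forall_exists_smul_mem`). Within one Eˣ-orbit the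
multipliers differ by elements of unit determinant, and units modulo squares are finite in number
(`finite_image_properClass_of_smul`). -/

namespace ShiftedLattice

set_option linter.unusedSectionVars false

/-! ### Proper endomorphisms of a quadratic plane and their commutativity. -/

section Plane

variable {F W : Type*} [Field F] [AddCommGroup W] [Module F W]

/-- An endomorphism whose adjoint with respect to `B` is its adjugate `tr A - A`. -/
def IsProperEnd (B : LinearMap.BilinForm F W) (A : Module.End F W) : Prop :=
  ∀ x y : W, B (A x) y = B x (LinearMap.trace F W A • y - A y)

lemma end_apply_apply_of_finrank_eq_two (hdim : Module.finrank F W = 2) (A : Module.End F W)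
    (x : W) : A (A x) = LinearMap.trace F W A • A x - LinearMap.det A • x := by
  have : Module.Finite F W := Module.finite_of_finrank_eq_succ hdim
  let b := Module.finBasisOfFinrankEq F W hdim
  have h : A * A = LinearMap.trace F W A • A - LinearMap.det A • 1 := by
    apply (LinearMap.toMatrix b b).injective
    rw [LinearMap.toMatrix_mul, map_sub, map_smul, map_smul, LinearMap.toMatrix_one,
      LinearMap.trace_eq_matrix_trace F b, ← LinearMap.det_toMatrix b]
    generalize LinearMap.toMatrix b b A = M
    ext i j
    fin_cases i <;> fin_cases j <;>
      simp [Matrix.mul_apply, Matrix.trace_fin_two, Matrix.det_fin_two, Fin.sum_univ_two] <;> ring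
  exact DFunLike.congr_fun h x

lemma IsProperEnd.apply_apply (hdim : Module.finrank F W = 2) {B : LinearMap.BilinForm F W}
    {A : Module.End F W} (hA : IsProperEnd B A) (x y : W) :
    B (A x) (A y) = LinearMap.det A * B x y := by
  rw [hA, end_apply_apply_of_finrank_eq_two hdim]
  simp

/-- An isometry has adjoint σ⁻¹, and by Cayley–Hamilton with determinant 1 this is tr σ - σ. Being
proper is a linear condition, so it survives base change and also covers the action of E, whose
elements need not be isometries. -/
lemma isProperEnd_of_mem (hdim : Module.finrank F W = 2) {B : LinearMap.BilinForm F W}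
    {σ : W ≃ₗ[F] W} (hσ : σ ∈ properOrthogonalGroup B) :
    IsProperEnd B (σ : W →ₗ[F] W) := by
  intro x y
  obtain ⟨h, hd⟩ := hσ
  rw [← h x]
  congr 1
  have := end_apply_apply_of_finrank_eq_two hdim (σ : W →ₗ[F] W) y
  rw [hd] at this
  simp only [LinearEquiv.coe_coe, one_smul] at this
  rw [map_sub, map_smul, LinearEquiv.coe_coe, this]
  abel

lemma mem_properOrthogonalGroup_of_isProperEnd (hdim : Module.finrank F W = 2)
    {B : LinearMap.BilinForm F W} {σ : W ≃ₗ[F] W} (hσ : IsProperEnd B (σ : W →ₗ[F] W))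
    (hd : LinearMap.det (σ : W →ₗ[F] W) = 1) : σ ∈ properOrthogonalGroup B :=
  ⟨fun x y => by simpa [hd] using hσ.apply_apply hdim x y, hd⟩

lemma IsProperEnd.commute [CharZero F] (hdim : Module.finrank F W = 2)
    {B : LinearMap.BilinForm F W} (hsymm : B.IsSymm) (hB : B ≠ 0) {A A' : Module.End F W}
    (hA : IsProperEnd B A) (hA' : IsProperEnd B A') : Commute A A' := by
  have : Module.Finite F W := Module.finite_of_finrank_eq_succ hdim
  let b := Module.finBasisOfFinrankEq F W hdim
  have hs : ∀ x y, B x y = B y x := fun x y => by simpa using (hsymm.eq x y)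
  have key : ∀ C : Module.End F W, IsProperEnd B C →
      let M := LinearMap.toMatrix b b C
      B (b 0) (b 0) * (M 0 0 - M 1 1) + 2 * B (b 0) (b 1) * M 1 0 = 0 ∧
      B (b 1) (b 1) * M 1 0 + B (b 0) (b 0) * M 0 1 = 0 ∧
      B (b 1) (b 1) * (M 0 0 - M 1 1) - 2 * B (b 0) (b 1) * M 0 1 = 0 := by
    intro C hC M
    have hCb : ∀ j, C (b j) = M 0 j • b 0 + M 1 j • b 1 := by
      intro j
      have := b.sum_repr (C (b j))
      rw [Fin.sum_univ_two] at this
      rw [← this]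
      simp [M, LinearMap.toMatrix_apply]
    have htr : LinearMap.trace F W C = M 0 0 + M 1 1 := by
      rw [LinearMap.trace_eq_matrix_trace F b, Matrix.trace_fin_two]
    have h00 := hC (b 0) (b 0)
    have h01 := hC (b 0) (b 1)
    have h11 := hC (b 1) (b 1)
    simp only [htr, hCb, map_add, map_sub, map_smul, LinearMap.add_apply, LinearMap.smul_apply,
      smul_eq_mul, hs (b 1) (b 0)] at h00 h01 h11
    exact ⟨by linear_combination h00, by linear_combination h01, by linear_combination -h11⟩
  have hne : B (b 0) (b 0) ≠ 0 ∨ B (b 0) (b 1) ≠ 0 ∨ B (b 1) (b 1) ≠ 0 := by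
    by_contra! h
    apply hB
    apply b.ext
    intro i
    apply b.ext
    intro j
    fin_cases i <;> fin_cases j <;> simp [h, hs (b 1) (b 0)]
  obtain ⟨k1, k2, k3⟩ := key A hA
  obtain ⟨l1, l2, l3⟩ := key A' hA'
  change A * A' = A' * A
  apply (LinearMap.toMatrix b b).injective
  rw [LinearMap.toMatrix_mul, LinearMap.toMatrix_mul]
  generalize LinearMap.toMatrix b b A = M at *
  generalize LinearMap.toMatrix b b A' = N at *
  generalize B (b 0) (b 0) = p at *
  generalize B (b 0) (b 1) = q at *
  generalize B (b 1) (b 1) = r at *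
  have h2 : (2 : F) ≠ 0 := two_ne_zero
  -- Since p, q, r are not all zero and 2 ≠ 0, the equations force (M₀₀ - M₁₁, M₀₁, M₁₀) to be a
  -- multiple of (-2q, -r, p), and likewise for N. The two vectors are proportional; the vanishing
  -- of their minors is the commutation relation.
  have e1 : M 0 1 * N 1 0 = N 0 1 * M 1 0 := by grind
  have e2 : M 0 1 * (N 0 0 - N 1 1) = N 0 1 * (M 0 0 - M 1 1) := by grind
  have e3 : M 1 0 * (N 0 0 - N 1 1) = N 1 0 * (M 0 0 - M 1 1) := by grind
  ext i j
  fin_cases i <;> fin_cases j <;> simp [Matrix.mul_apply, Fin.sum_univ_two] <;>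
    first | linear_combination e1 | linear_combination -e1 | linear_combination e2 | linear_combination -e2 | linear_combination e3

lemma mul_comm_of_mem [CharZero F] (hdim : Module.finrank F W = 2)
    {B : LinearMap.BilinForm F W} (hsymm : B.IsSymm) (hB : B ≠ 0) {σ τ : W ≃ₗ[F] W}
    (hσ : σ ∈ properOrthogonalGroup B) (hτ : τ ∈ properOrthogonalGroup B) : σ * τ = τ * σ := by
  have := (isProperEnd_of_mem hdim hσ).commute hdim hsymm hB (isProperEnd_of_mem hdim hτ)
  ext x
  exact DFunLike.congr_fun this x

end Plane

/-! ### Cosets of subgroups, their stabilizers and their orbits. -/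

section Coset

variable {W : Type*} [AddCommGroup W]

/-- The coset `Λ + u`. -/
def coset (Λ : AddSubgroup W) (u : W) : Set W := {x | ∃ l ∈ Λ, x = l + u}

lemma mem_coset {Λ : AddSubgroup W} {u x : W} : x ∈ coset Λ u ↔ x - u ∈ Λ :=
  ⟨by rintro ⟨l, hl, rfl⟩; simpa, fun h => ⟨_, h, by abel⟩⟩

lemma coset_eq_coset_iff {Λ Λ' : AddSubgroup W} {u u' : W} :
    coset Λ u = coset Λ' u' ↔ Λ = Λ' ∧ u - u' ∈ Λ := by
  constructor
  · intro h
    have hu : u - u' ∈ Λ' := mem_coset.1 (h ▸ mem_coset.2 (by simp))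
    have hΛ : Λ = Λ' := by
      ext x
      have hx := Set.ext_iff.1 h (x + u)
      rw [mem_coset, mem_coset, add_sub_cancel_right, add_sub_assoc] at hx
      rw [hx, AddSubgroup.add_mem_cancel_right _ hu]
    exact ⟨hΛ, hΛ ▸ hu⟩
  · rintro ⟨rfl, h⟩
    ext x
    rw [mem_coset, mem_coset, ← AddSubgroup.add_mem_cancel_right Λ h (y := x - u), sub_add_sub_cancel]

lemma coset_zero (Λ : AddSubgroup W) : coset Λ 0 = Λ := by
  ext x
  simp [mem_coset]

lemma smul_coset {G : Type*} [Group G] [DistribMulAction G W] (g : G) (Λ : AddSubgroup W) (u : W) :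
    g • coset Λ u = coset (g • Λ) (g • u) := by
  ext x
  rw [Set.mem_smul_set_iff_inv_smul_mem, mem_coset, mem_coset,
    AddSubgroup.mem_pointwise_smul_iff_inv_smul_mem, smul_sub, inv_smul_smul]

end Coset

section Stabilizer

variable {F W : Type*} [Field F] [AddCommGroup W] [Module F W]

lemma mem_properStabilizer_coset {B : LinearMap.BilinForm F W} {Λ : AddSubgroup W} {u : W}
    {σ : W ≃ₗ[F] W} : σ ∈ properStabilizer B (coset Λ u) ↔
      σ ∈ properOrthogonalGroup B ∧ σ • Λ = Λ ∧ σ u - u ∈ Λ := by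
  rw [properStabilizer, Subgroup.mem_inf, MulAction.mem_stabilizer_iff, smul_coset,
    coset_eq_coset_iff]
  refine and_congr_right fun _ => ⟨fun ⟨h, h'⟩ => ⟨h, h ▸ h'⟩, fun ⟨h, h'⟩ => ⟨h, ?_⟩⟩
  rw [h]; exact h'

lemma mem_properClass_iff {B : LinearMap.BilinForm F W} {X Y : Set W} :
    Y ∈ properClass B X ↔ ∃ σ ∈ properOrthogonalGroup B, σ • X = Y := by
  rw [properClass, MulAction.mem_orbit_iff]
  exact ⟨fun ⟨σ, h⟩ => ⟨σ, σ.2, h⟩, fun ⟨σ, hσ, h⟩ => ⟨⟨σ, hσ⟩, h⟩⟩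

lemma properClass_eq_iff {B : LinearMap.BilinForm F W} {X Y : Set W} :
    properClass B X = properClass B Y ↔ ∃ σ ∈ properOrthogonalGroup B, σ • Y = X := by
  rw [← mem_properClass_iff]
  exact MulAction.orbit_eq_iff

end Stabilizer

/-! ### Approximation of p-adic numbers by elements of K integral away from p. -/

section Approximation

variable {K : Type*} [Field K] [NumberField K]

lemma valuation_le_one_of_mul_eq (p : HeightOneSpectrum (𝓞 K)) {x : K} {s t : 𝓞 K}
    (hs : s ∉ p.asIdeal) (h : algebraMap (𝓞 K) K s * x = algebraMap (𝓞 K) K t) : p.valuation K x ≤ 1 := by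
  have h1 : p.valuation K (algebraMap (𝓞 K) K s) = 1 := p.valuation_eq_one_iff_notMem.2 hs
  have h2 : p.valuation K (algebraMap (𝓞 K) K t) ≤ 1 := p.valuation_le_one t
  rwa [← h, map_mul, h1, one_mul] at h2

lemma mem_adicCompletionIntegers_algebraMap_iff (p : HeightOneSpectrum (𝓞 K)) (x : K) :
    algebraMap K (p.adicCompletion K) x ∈ p.adicCompletionIntegers K ↔ p.valuation K x ≤ 1 := by
  rw [HeightOneSpectrum.mem_adicCompletionIntegers,
    ← HeightOneSpectrum.valuedAdicCompletion_eq_valuation' p x]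
  rfl

lemma exists_algebraMap_sub_mem (p : HeightOneSpectrum (𝓞 K)) (x : p.adicCompletion K) :
    ∃ y : K, algebraMap K (p.adicCompletion K) y - x ∈ p.adicCompletionIntegers K := by
  have hopen : IsOpen {z : p.adicCompletion K | z - x ∈ p.adicCompletionIntegers K} := by
    have h1 : IsOpen (p.adicCompletionIntegers K : Set (p.adicCompletion K)) :=
      Valued.isOpen_valuationSubring _
    exact h1.preimage (continuous_id.sub continuous_const)
  obtain ⟨y, hy⟩ := (HeightOneSpectrum.denseRange_algebraMap p (K := K)).exists_mem_open hopen
    ⟨x, by simp⟩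
  exact ⟨y, hy⟩

/-- A number field element can be moved into the integers away from `p` without changing its
`p`-adic polar part. -/
lemma exists_valuation_sub_le_one (p : HeightOneSpectrum (𝓞 K)) (x : K) :
    ∃ y : K, p.valuation K (y - x) ≤ 1 ∧
      ∀ q : HeightOneSpectrum (𝓞 K), q ≠ p → q.valuation K y ≤ 1 := by
  obtain ⟨n, d, hd, rfl⟩ := IsFractionRing.div_surjective (A := 𝓞 K) x
  have hd0 : d ≠ 0 := nonZeroDivisors.ne_zero hd
  have hdK : (algebraMap (𝓞 K) K d) ≠ 0 := by simpa using hd0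
  have hp : Prime p.asIdeal := p.prime
  obtain ⟨J, hpJ, hJ⟩ := (FiniteMultiplicity.of_prime_left hp
    (b := Ideal.span {d}) (by simpa using hd0)).exists_eq_pow_mul_and_not_dvd
  generalize multiplicity p.asIdeal (Ideal.span {d}) = k at hpJ
  have hJp : ¬ J ≤ p.asIdeal := fun h => hJ (Ideal.dvd_iff_le.2 h)
  have hmax : p.asIdeal.IsMaximal := p.isPrime.isMaximal p.ne_bot
  have hcop : IsCoprime (p.asIdeal ^ k) J := by
    apply IsCoprime.pow_left
    rw [Ideal.isCoprime_iff_sup_eq]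
    exact hmax.1.2 _ (left_lt_sup.2 hJp)
  -- With (d) = p^k J and α + β = 1, take y = βx. Then y - x = -αx is integral at p, because α
  -- clears p^k and an element of J outside p clears the rest; y is integral elsewhere, because β
  -- clears J.
  obtain ⟨α, hα, β, hβ, hαβ⟩ := Ideal.isCoprime_iff_exists.1 hcop
  have hdvd : ∀ s ∈ p.asIdeal ^ k, ∀ t ∈ J, ∃ c, s * t = d * c := fun s hs t ht => by
    have : s * t ∈ Ideal.span {d} := hpJ ▸ Ideal.mul_mem_mul hs ht
    obtain ⟨c, hc⟩ := Ideal.mem_span_singleton'.1 this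
    exact ⟨c, by rw [← hc, mul_comm]⟩
  refine ⟨algebraMap (𝓞 K) K β * (algebraMap (𝓞 K) K n / algebraMap (𝓞 K) K d), ?_, ?_⟩
  · obtain ⟨s, hsJ, hsp⟩ := SetLike.not_le_iff_exists.1 hJp
    obtain ⟨c, hc⟩ := hdvd α hα s hsJ
    refine valuation_le_one_of_mul_eq p hsp (t := -(c * n)) ?_
    have h1 := congrArg (algebraMap (𝓞 K) K) hc
    have h2 := congrArg (algebraMap (𝓞 K) K) hαβ
    simp only [map_mul, map_add, map_one, map_neg] at h1 h2 ⊢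
    field_simp
    linear_combination (-algebraMap (𝓞 K) K n) * h1 + algebraMap (𝓞 K) K s * algebraMap (𝓞 K) K n * h2
  · intro q hq
    have hqp : ¬ p.asIdeal ^ k ≤ q.asIdeal := fun h => hq <| by
      have := q.isPrime.le_of_pow_le h
      exact (HeightOneSpectrum.ext (hmax.eq_of_le q.isPrime.ne_top this)).symm
    obtain ⟨s, hsp, hsq⟩ := SetLike.not_le_iff_exists.1 hqp
    obtain ⟨c, hc⟩ := hdvd s hsp β hβ
    refine valuation_le_one_of_mul_eq q hsq (t := c * n) ?_
    have h1 := congrArg (algebraMap (𝓞 K) K) hc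
    simp only [map_mul] at h1 ⊢
    field_simp
    linear_combination (algebraMap (𝓞 K) K n) * h1

lemma exists_algebraMap_sub_mem_and_forall_ne (p : HeightOneSpectrum (𝓞 K))
    (x : p.adicCompletion K) :
    ∃ y : K, algebraMap K (p.adicCompletion K) y - x ∈ p.adicCompletionIntegers K ∧
      ∀ q : HeightOneSpectrum (𝓞 K), q ≠ p → q.valuation K y ≤ 1 := by
  obtain ⟨z, hz⟩ := exists_algebraMap_sub_mem p x
  obtain ⟨y, hy, hq⟩ := exists_valuation_sub_le_one p z
  refine ⟨y, ?_, hq⟩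
  rw [← mem_adicCompletionIntegers_algebraMap_iff, map_sub] at hy
  simpa using add_mem hy hz

lemma exists_integer_sub_eq_mul (p : HeightOneSpectrum (𝓞 K)) {x : p.adicCompletion K}
    (hx : x ∈ p.adicCompletionIntegers K) {d : 𝓞 K} (hd : d ≠ 0) :
    ∃ c : 𝓞 K, ∃ e ∈ p.adicCompletionIntegers K,
      x - algebraMap K (p.adicCompletion K) (algebraMap (𝓞 K) K c) =
        algebraMap K (p.adicCompletion K) (algebraMap (𝓞 K) K d) * e := by
  have hdK : algebraMap K (p.adicCompletion K) (algebraMap (𝓞 K) K d) ≠ 0 := by simpa using hd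
  obtain ⟨y, hy, hq⟩ := exists_algebraMap_sub_mem_and_forall_ne p
    (x / algebraMap K (p.adicCompletion K) (algebraMap (𝓞 K) K d))
  have hint : ∀ q : HeightOneSpectrum (𝓞 K),
      algebraMap K (q.adicCompletion K) (algebraMap (𝓞 K) K d) ∈ q.adicCompletionIntegers K := fun q =>
    (mem_adicCompletionIntegers_algebraMap_iff q _).2 (q.valuation_le_one d)
  -- Here y approximates x/d. At p, dy = d(y - x/d) + x is integral; at other places both factors
  -- are.
  obtain ⟨c, hc⟩ := HeightOneSpectrum.mem_integers_of_valuation_le_one K (algebraMap (𝓞 K) K d * y) (by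
    intro q
    by_cases h : q = p
    · subst h
      rw [← mem_adicCompletionIntegers_algebraMap_iff]
      convert add_mem (mul_mem (hint q) hy) hx using 1
      rw [map_mul]
      field_simp
      ring
    · rw [map_mul]
      exact mul_le_one' (q.valuation_le_one d) (hq q h))
  refine ⟨c, _, neg_mem hy, ?_⟩
  rw [hc, map_mul]
  field_simp
  ring

end Approximation
-- Localizations of a lattice: local-global principle and strong approximation.
section LocalLattice

variable {K V : Type*} [Field K] [NumberField K] [AddCommGroup V] [Module K V] [Module (𝓞 K) V]

/-- The `𝓞_p`-submodule of `K_p ⊗ V` generated by `L`. -/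
noncomputable def localLattice (p : HeightOneSpectrum (𝓞 K)) (L : Submodule (𝓞 K) V) :
    Submodule (p.adicCompletionIntegers K).toSubring (p.adicCompletion K ⊗[K] V) :=
  Submodule.span _ ((fun w : V => (1 : p.adicCompletion K) ⊗ₜ[K] w) '' (L : Set V))

lemma shift_eq_coset (L : Submodule (𝓞 K) V) (ν : V) : shift L ν = coset L.toAddSubgroup ν := rfl

lemma finiteLocalization_eq_coset (p : HeightOneSpectrum (𝓞 K)) (L : Submodule (𝓞 K) V) (ν : V) :
    finiteLocalization p L ν =
      coset (localLattice p L).toAddSubgroup ((1 : p.adicCompletion K) ⊗ₜ[K] ν) := rfl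

lemma tmul_mem_localLattice (p : HeightOneSpectrum (𝓞 K)) {L : Submodule (𝓞 K) V} {v : V}
    (hv : v ∈ L) : (1 : p.adicCompletion K) ⊗ₜ[K] v ∈ localLattice p L :=
  Submodule.subset_span ⟨v, hv, rfl⟩

lemma smul_mem_localLattice (p : HeightOneSpectrum (𝓞 K)) {L : Submodule (𝓞 K) V}
    {c : p.adicCompletion K} (hc : c ∈ p.adicCompletionIntegers K) {u : p.adicCompletion K ⊗[K] V}
    (hu : u ∈ localLattice p L) : c • u ∈ localLattice p L :=
  (localLattice p L).smul_mem ⟨c, hc⟩ hu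

@[elab_as_elim]
lemma localLattice_induction {p : HeightOneSpectrum (𝓞 K)} {L : Submodule (𝓞 K) V}
    {P : ∀ u, u ∈ localLattice p L → Prop}
    (tmul : ∀ l (hl : l ∈ L), P (1 ⊗ₜ l) (tmul_mem_localLattice p hl))
    (add : ∀ x y hx hy, P x hx → P y hy → P (x + y) (add_mem hx hy))
    (smul : ∀ c (hc : c ∈ p.adicCompletionIntegers K) x hx, P x hx →
      P (c • x) (smul_mem_localLattice p hc hx))
    {u : p.adicCompletion K ⊗[K] V} (hu : u ∈ localLattice p L) : P u hu := by
  refine Submodule.span_induction (p := P) ?_ ?_ (fun x y => add x y)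
    (fun c x => smul c.1 c.2 x) hu
  · rintro _ ⟨l, hl, rfl⟩
    exact tmul l hl
  · have := tmul 0 L.zero_mem
    simpa using this

lemma baseChange_mem_localLattice (p : HeightOneSpectrum (𝓞 K)) {L M : Submodule (𝓞 K) V}
    {f : V →ₗ[K] V} (hf : ∀ l ∈ L, f l ∈ M) {u : p.adicCompletion K ⊗[K] V}
    (hu : u ∈ localLattice p L) : f.baseChange (p.adicCompletion K) u ∈ localLattice p M := by
  induction hu using localLattice_induction with
  | tmul l hl => exact tmul_mem_localLattice p (hf l hl)
  | add x y _ _ hx hy => rw [map_add]; exact add_mem hx hy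
  | smul c hc x _ hx => rw [map_smul]; exact smul_mem_localLattice p hc hx

lemma repr_mem_of_mem_localLattice {ι : Type*} [Finite ι] (b : Module.Basis ι K V)
    (p : HeightOneSpectrum (𝓞 K)) {L : Submodule (𝓞 K) V}
    (hL : ∀ l ∈ L, ∀ i, b.repr l i ∈ Set.range (algebraMap (𝓞 K) K))
    {u : p.adicCompletion K ⊗[K] V} (hu : u ∈ localLattice p L) (i : ι) :
    (b.baseChange (p.adicCompletion K)).repr u i ∈ p.adicCompletionIntegers K := by
  induction hu using localLattice_induction with
  | tmul l hl =>
    obtain ⟨c, hc⟩ := hL l hl i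
    rw [Module.Basis.baseChange_repr_tmul, ← hc, Algebra.smul_def, mul_one,
      mem_adicCompletionIntegers_algebraMap_iff]
    exact p.valuation_le_one c
  | add x y _ _ hx hy => rw [map_add]; exact add_mem hx hy
  | smul c hc x _ hx => rw [map_smul]; exact mul_mem hc hx

lemma sum_smul_mem_localLattice {ι : Type*} [Fintype ι] (b : Module.Basis ι K V)
    (p : HeightOneSpectrum (𝓞 K)) {L : Submodule (𝓞 K) V} (hL : ∀ i, b i ∈ L)
    {u : p.adicCompletion K ⊗[K] V}
    (hu : ∀ i, (b.baseChange (p.adicCompletion K)).repr u i ∈ p.adicCompletionIntegers K) :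
    u ∈ localLattice p L := by
  rw [← (b.baseChange (p.adicCompletion K)).sum_repr u]
  refine sum_mem fun i _ => smul_mem_localLattice p (hu i) ?_
  rw [Module.Basis.baseChange_apply]
  exact tmul_mem_localLattice p (hL i)

lemma IsLattice.exists_basis [Module.Finite K V] {L : Submodule (𝓞 K) V} (hL : IsLattice K L) :
    ∃ b : Module.Basis (Fin (Module.finrank K V)) K V, ∀ i, b i ∈ L := by
  let b := Module.Basis.ofSpan hL.2.ge
  have : Fintype _ := FiniteDimensional.fintypeBasisIndex b
  have hb : ∀ i, b i ∈ L := fun i => Module.Basis.ofSpan_subset hL.2.ge ⟨i, rfl⟩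
  refine ⟨b.reindex (Fintype.equivFinOfCardEq (Module.finrank_eq_card_basis b).symm), fun i => ?_⟩
  rw [Module.Basis.reindex_apply]
  exact hb _

variable [IsScalarTower (𝓞 K) K V]

lemma exists_smul_mem_of_basis {ι : Type*} [Fintype ι] (b : Module.Basis ι K V)
    {L : Submodule (𝓞 K) V} (hL : ∀ i, b i ∈ L) (v : V) : ∃ d : 𝓞 K, d ≠ 0 ∧ d • v ∈ L := by
  classical
  obtain ⟨d, hd⟩ := IsLocalization.exist_integer_multiples (nonZeroDivisors (𝓞 K)) Finset.univ
    (fun i => b.repr v i)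
  refine ⟨d, nonZeroDivisors.ne_zero d.2, ?_⟩
  rw [← b.sum_repr v, Finset.smul_sum]
  refine sum_mem fun i _ => ?_
  obtain ⟨c, hc⟩ := hd i (Finset.mem_univ i)
  rw [← smul_assoc, ← hc, algebraMap_smul]
  exact L.smul_mem _ (hL i)

lemma exists_forall_smul_mem {L M : Submodule (𝓞 K) V} (hL : ∀ v, ∃ d : 𝓞 K, d ≠ 0 ∧ d • v ∈ L)
    (hM : M.FG) : ∃ d : 𝓞 K, d ≠ 0 ∧ ∀ m ∈ M, d • m ∈ L := by
  classical
  obtain ⟨S, rfl⟩ := hM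
  choose f hf hfL using hL
  refine ⟨∏ s ∈ S, f s, Finset.prod_ne_zero_iff.2 fun s _ => hf s, fun m hm => ?_⟩
  induction hm using Submodule.span_induction with
  | mem x hx =>
    rw [← Finset.prod_erase_mul S f hx, mul_smul]
    exact L.smul_mem _ (hfL x)
  | zero => simp
  | add x y _ _ hx hy => rw [smul_add]; exact add_mem hx hy
  | smul a x _ hx => rw [smul_comm]; exact L.smul_mem _ hx

/-- This is L_p = L + dL_p, obtained by approximating coefficients modulo d. -/
lemma exists_sub_tmul_eq_smul (p : HeightOneSpectrum (𝓞 K)) {L : Submodule (𝓞 K) V}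
    {u : p.adicCompletion K ⊗[K] V} (hu : u ∈ localLattice p L) {d : 𝓞 K} (hd : d ≠ 0) :
    ∃ l ∈ L, ∃ w ∈ localLattice p L,
      u - 1 ⊗ₜ l = algebraMap K (p.adicCompletion K) (algebraMap (𝓞 K) K d) • w := by
  induction hu using localLattice_induction with
  | tmul l hl => exact ⟨l, hl, 0, zero_mem _, by simp⟩
  | add x y _ _ hx hy =>
    obtain ⟨l, hl, w, hw, h⟩ := hx
    obtain ⟨l', hl', w', hw', h'⟩ := hy
    refine ⟨l + l', add_mem hl hl', w + w', add_mem hw hw', ?_⟩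
    rw [TensorProduct.tmul_add, smul_add, ← h, ← h']
    abel
  | smul c hc x _ hx =>
    obtain ⟨l, hl, w, hw, h⟩ := hx
    obtain ⟨c', e, he, h'⟩ := exists_integer_sub_eq_mul p hc hd
    refine ⟨c' • l, L.smul_mem _ hl, c • w + e • 1 ⊗ₜ l, add_mem (smul_mem_localLattice p hc hw)
      (smul_mem_localLattice p he (tmul_mem_localLattice p hl)), ?_⟩
    rw [smul_add, smul_comm _ c w, ← h, smul_smul, ← h', sub_smul, smul_sub,
      ← algebraMap_smul K c' l, TensorProduct.tmul_smul,
      algebraMap_smul (p.adicCompletion K) (algebraMap (𝓞 K) K c')]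
    abel

lemma smul_mem_localLattice_of_forall (p : HeightOneSpectrum (𝓞 K)) {L M : Submodule (𝓞 K) V}
    {d : 𝓞 K} (hd : ∀ l ∈ L, d • l ∈ M) {u : p.adicCompletion K ⊗[K] V}
    (hu : u ∈ localLattice p L) :
    algebraMap K (p.adicCompletion K) (algebraMap (𝓞 K) K d) • u ∈ localLattice p M := by
  have := baseChange_mem_localLattice p (M := M) (f := algebraMap (𝓞 K) K d • LinearMap.id)
    (by simpa using hd) hu
  rwa [LinearMap.baseChange_smul, LinearMap.baseChange_id, LinearMap.smul_apply, LinearMap.id_apply,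
    ← algebraMap_smul (p.adicCompletion K)] at this

/-- A lattice is the intersection of its localizations. -/
lemma mem_of_forall_tmul_mem_localLattice [Module.Finite K V] {L : Submodule (𝓞 K) V}
    (hL : IsLattice K L) {v : V}
    (hv : ∀ p : HeightOneSpectrum (𝓞 K), 1 ⊗ₜ v ∈ localLattice p L) : v ∈ L := by
  obtain ⟨b, hb⟩ := hL.exists_basis
  let F : Submodule (𝓞 K) V := Submodule.span (𝓞 K) (Set.range b)
  have hbF : ∀ i, b i ∈ F := fun i => Submodule.subset_span ⟨i, rfl⟩
  have hFL : F ≤ L := Submodule.span_le.2 (by rintro _ ⟨i, rfl⟩; exact hb i)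
  have hFrepr : ∀ l ∈ F, ∀ i, b.repr l i ∈ Set.range (algebraMap (𝓞 K) K) := by
    intro l hl i
    exact (b.mem_span_iff_repr_mem (𝓞 K) l).1 hl i
  obtain ⟨d, hd, hdL⟩ := exists_forall_smul_mem (exists_smul_mem_of_basis b hbF) hL.1
  -- Let d carry L into the free lattice F ⊆ L spanned by b. Writing v = l + dw with l ∈ L and w ∈
  -- L_p puts v - l in F_p, where membership is read off from coordinates; a common denominator s
  -- prime to p then gives sv ∈ L. Thus {a : av ∈ L} lies in no maximal ideal.
  have key : ∀ p : HeightOneSpectrum (𝓞 K), ∃ s : 𝓞 K, s ∉ p.asIdeal ∧ s • v ∈ L := by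
    intro p
    obtain ⟨l, hl, w, hw, h⟩ := exists_sub_tmul_eq_smul p (hv p) hd
    have h1 := smul_mem_localLattice_of_forall p hdL hw
    rw [← h, ← TensorProduct.tmul_sub] at h1
    have h2 := repr_mem_of_mem_localLattice b p hFrepr h1
    simp only [Module.Basis.baseChange_repr_tmul, Algebra.smul_def, mul_one,
      mem_adicCompletionIntegers_algebraMap_iff] at h2
    choose n s hs using fun i => p.exists_primeCompl_mul_eq_of_integer (b.repr (v - l) i) (h2 i)
    refine ⟨(∏ i, s i : p.asIdeal.primeCompl), (∏ i, s i : p.asIdeal.primeCompl).2, ?_⟩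
    rw [← sub_add_cancel v l, smul_add]
    refine add_mem (hFL ?_) (L.smul_mem _ hl)
    rw [← b.sum_repr (v - l), Finset.smul_sum]
    refine sum_mem fun i _ => ?_
    rw [← Finset.prod_erase_mul _ s (Finset.mem_univ i), Submonoid.coe_mul, mul_smul]
    refine F.smul_mem _ ?_
    rw [← smul_assoc, Algebra.smul_def, mul_comm, hs, algebraMap_smul]
    exact F.smul_mem _ (hbF i)
  have htop : conductor L v = ⊤ := by
    by_contra hne
    obtain ⟨m, hm, hle⟩ := Ideal.exists_le_maximal _ hne
    have hm0 : m ≠ ⊥ := by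
      rintro rfl
      obtain ⟨c, hc, hcL⟩ := exists_smul_mem_of_basis b hb v
      exact hc (Ideal.mem_bot.1 (hle hcL))
    obtain ⟨s, hs, hsv⟩ := key ⟨m, hm.isPrime, hm0⟩
    exact hs (hle hsv)
  have : (1 : 𝓞 K) ∈ conductor L v := htop ▸ Submodule.mem_top
  simpa using (show (1 : 𝓞 K) • v ∈ L from this)

lemma le_of_forall_localLattice_le [Module.Finite K V] {L M : Submodule (𝓞 K) V}
    (hM : IsLattice K M) (h : ∀ p : HeightOneSpectrum (𝓞 K),
      (localLattice p L).toAddSubgroup ≤ (localLattice p M).toAddSubgroup) : L ≤ M :=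
  fun _ hv => mem_of_forall_tmul_mem_localLattice hM fun p => h p (tmul_mem_localLattice p hv)

lemma eq_of_forall_localLattice_eq [Module.Finite K V] {L M : Submodule (𝓞 K) V}
    (hL : IsLattice K L) (hM : IsLattice K M) (h : ∀ p : HeightOneSpectrum (𝓞 K),
      (localLattice p L).toAddSubgroup = (localLattice p M).toAddSubgroup) : L = M :=
  le_antisymm (le_of_forall_localLattice_le hM fun p => (h p).le)
    (le_of_forall_localLattice_le hL fun p => (h p).ge)

lemma exists_tmul_sub_mem_and_forall_ne [Module.Finite K V] {L : Submodule (𝓞 K) V}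
    (hL : IsLattice K L) (p : HeightOneSpectrum (𝓞 K)) (u : p.adicCompletion K ⊗[K] V) :
    ∃ v : V, 1 ⊗ₜ v - u ∈ localLattice p L ∧
      ∀ q : HeightOneSpectrum (𝓞 K), q ≠ p → 1 ⊗ₜ v ∈ localLattice q L := by
  obtain ⟨b, hb⟩ := hL.exists_basis
  choose y hy hq using fun i => exists_algebraMap_sub_mem_and_forall_ne p
    ((b.baseChange (p.adicCompletion K)).repr u i)
  refine ⟨∑ i, y i • b i, sum_smul_mem_localLattice b p hb fun i => ?_, fun q hqp =>
    sum_smul_mem_localLattice b q hb fun i => ?_⟩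
  · rw [map_sub, Finsupp.sub_apply, Module.Basis.baseChange_repr_tmul, b.repr_sum_self,
      Algebra.smul_def, mul_one]
    exact hy i
  · rw [Module.Basis.baseChange_repr_tmul, b.repr_sum_self, Algebra.smul_def, mul_one,
      mem_adicCompletionIntegers_algebraMap_iff]
    exact hq i q hqp

/-- Strong approximation for `V` with respect to a lattice. -/
lemma exists_forall_tmul_sub_mem [Module.Finite K V] {L : Submodule (𝓞 K) V}
    (hL : IsLattice K L) (S : Finset (HeightOneSpectrum (𝓞 K)))
    (u : ∀ p : HeightOneSpectrum (𝓞 K), p.adicCompletion K ⊗[K] V) :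
    ∃ v : V, (∀ p ∈ S, 1 ⊗ₜ v - u p ∈ localLattice p L) ∧
      ∀ p ∉ S, 1 ⊗ₜ v ∈ localLattice p L := by
  classical
  induction S using Finset.induction_on with
  | empty => exact ⟨0, by simp, by simp⟩
  | insert p S hp ih =>
    obtain ⟨v, hv, hv'⟩ := ih
    obtain ⟨w, hw, hw'⟩ := exists_tmul_sub_mem_and_forall_ne hL p (u p)
    refine ⟨v + w, fun q hq => ?_, fun q hq => ?_⟩
    · rw [TensorProduct.tmul_add]
      rcases Finset.mem_insert.1 hq with rfl | hq
      · rw [add_sub_assoc]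
        exact add_mem (hv' _ hp) hw
      · rw [add_sub_right_comm]
        exact add_mem (hv q hq) (hw' q fun h => hp (h ▸ hq))
    · rw [Finset.mem_insert, not_or] at hq
      rw [TensorProduct.tmul_add]
      exact add_mem (hv' q hq.2) (hw' q hq.1)

end LocalLattice
-- Finiteness of quotients of a finitely generated module by a nonzero scalar.
lemma finite_image_of_factor {α β γ : Type*} [Finite γ] {D : Set α} (f : α → β) (g : α → γ)
    (h : ∀ x ∈ D, ∀ y ∈ D, g x = g y → f x = f y) : (f '' D).Finite := by
  have hsub : f '' D ⊆ Set.range fun c : g '' D => f c.2.choose := by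
    rintro _ ⟨x, hx, rfl⟩
    have hc : g x ∈ g '' D := ⟨x, hx, rfl⟩
    exact ⟨⟨g x, hc⟩, h _ hc.choose_spec.1 _ hx hc.choose_spec.2⟩
  exact (Set.finite_range _).subset hsub

lemma finite_quotient_span_smul_top {R M : Type*} [CommRing R] [Ring.HasFiniteQuotients R]
    [AddCommGroup M] [Module R M] {L : Submodule R M} (hL : L.FG) {d : R} (hd : d ≠ 0) :
    Finite (L ⧸ (Ideal.span {d} • (⊤ : Submodule R L))) := by
  have : Finite (R ⧸ Ideal.span {d}) :=
    Ring.HasFiniteQuotients.finiteQuotient (by simpa using hd)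
  have : Subsingleton (L ⧸ (⊤ : Submodule R L)) := Submodule.Quotient.subsingleton_iff.2 rfl
  exact Submodule.finite_quotient_smul _ ((Submodule.fg_top L).2 hL)

lemma exists_sub_eq_smul_of_mk_eq {R M : Type*} [CommRing R] [AddCommGroup M] [Module R M]
    {L : Submodule R M} {d : R} {x y : L}
    (h : (Submodule.Quotient.mk x : L ⧸ (Ideal.span {d} • (⊤ : Submodule R L))) =
      Submodule.Quotient.mk y) : ∃ z ∈ L, (x : M) - y = d • z := by
  rw [Submodule.Quotient.eq, Submodule.ideal_span_singleton_smul,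
    Submodule.mem_smul_pointwise_iff_exists] at h
  obtain ⟨z, -, hz⟩ := h
  exact ⟨z, z.2, (congrArg Subtype.val hz).symm⟩

/-- Multiplication by d embeds d⁻¹L/L into L/dL, which is finite. -/
lemma finite_image_setOf_smul_mem {R M β : Type*} [CommRing R] [Ring.HasFiniteQuotients R]
    [AddCommGroup M] [Module R M] {L : Submodule R M} (hL : L.FG) {d : R} (hd : d ≠ 0)
    (hdM : Function.Injective fun m : M => d • m) (f : M → β)
    (hf : ∀ v w, v - w ∈ L → f v = f w) : (f '' {v | d • v ∈ L}).Finite := by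
  classical
  have := finite_quotient_span_smul_top hL hd
  refine finite_image_of_factor f (γ := L ⧸ (Ideal.span {d} • (⊤ : Submodule R L)))
    (fun v => if h : d • v ∈ L then Submodule.Quotient.mk ⟨d • v, h⟩ else 0) ?_
  intro v hv w hw hvw
  rw [Set.mem_ofPred_eq] at hv hw
  rw [dif_pos hv, dif_pos hw] at hvw
  obtain ⟨z, hz, h⟩ := exists_sub_eq_smul_of_mk_eq hvw
  rw [← smul_sub] at h
  exact hf v w (hdM h ▸ hz)

/-! ### Base change of automorphisms and of proper endomorphisms. -/

section BaseChange

variable {K V : Type*} [Field K] [AddCommGroup V] [Module K V]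

/-- Base change of automorphisms, as a group homomorphism. -/
noncomputable def baseChangeAut (F : Type*) [Field F] [Algebra K F] :
    (V ≃ₗ[K] V) →* (F ⊗[K] V ≃ₗ[F] F ⊗[K] V) where
  toFun g := LinearEquiv.baseChange K F V V g
  map_one' := by
    apply LinearEquiv.toLinearMap_injective
    ext x
    simp
  map_mul' g h := by
    apply LinearEquiv.toLinearMap_injective
    ext x
    simp

variable (F : Type*) [Field F] [Algebra K F]

@[simp]
lemma baseChangeAut_tmul (g : V ≃ₗ[K] V) (c : F) (v : V) :
    baseChangeAut F g (c ⊗ₜ v) = c ⊗ₜ g v := rfl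

lemma coe_baseChangeAut (g : V ≃ₗ[K] V) :
    (baseChangeAut F g : F ⊗[K] V →ₗ[F] F ⊗[K] V) = (g : V →ₗ[K] V).baseChange F := rfl

lemma IsProperEnd.baseChange [Module.Finite K V] {B : LinearMap.BilinForm K V}
    {A : Module.End K V} (hA : IsProperEnd B A) :
    IsProperEnd (B.baseChange F) (A.baseChange F) := by
  intro x y
  rw [LinearMap.trace_baseChange]
  induction x with
  | zero => simp
  | add x x' h h' => simp only [map_add, LinearMap.add_apply, h, h']
  | tmul a v =>
    induction y with
    | zero => simp
    | add y y' h h' =>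
      rw [map_add, h, h', map_add, ← map_add]
      congr 1
      rw [smul_add]
      abel
    | tmul c w =>
      have := hA v w
      rw [algebraMap_smul, ← TensorProduct.tmul_smul, LinearMap.baseChange_tmul,
        LinearMap.baseChange_tmul, ← TensorProduct.tmul_sub,
        LinearMap.BilinForm.baseChange_tmul, LinearMap.BilinForm.baseChange_tmul, this]

lemma baseChangeAut_mem (hdim : Module.finrank K V = 2) {B : LinearMap.BilinForm K V}
    {g : V ≃ₗ[K] V} (hg : g ∈ properOrthogonalGroup B) :
    baseChangeAut F g ∈ properOrthogonalGroup (B.baseChange F) := by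
  have : Module.Finite K V := Module.finite_of_finrank_eq_succ hdim
  refine mem_properOrthogonalGroup_of_isProperEnd ?_ ((isProperEnd_of_mem hdim hg).baseChange F) ?_
  · rw [Module.finrank_baseChange, hdim]
  · rw [coe_baseChangeAut, LinearMap.det_baseChange, hg.2, map_one]

end BaseChange

/-! ### The genus in terms of finite places, the conductor, and finiteness of local indices. -/

section Genus

variable {K V : Type*} [Field K] [NumberField K] [AddCommGroup V] [Module K V] [Module (𝓞 K) V]
  [IsScalarTower (𝓞 K) K V]

instance charZero_adicCompletion (p : HeightOneSpectrum (𝓞 K)) : CharZero (p.adicCompletion K) :=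
  charZero_of_injective_algebraMap (algebraMap K (p.adicCompletion K)).injective

lemma smul_localLattice (p : HeightOneSpectrum (𝓞 K)) (g : V ≃ₗ[K] V) (L : Submodule (𝓞 K) V) :
    baseChangeAut (p.adicCompletion K) g • (localLattice p L).toAddSubgroup =
      (localLattice p (g • L)).toAddSubgroup := by
  have key : ∀ (h : V ≃ₗ[K] V) (M : Submodule (𝓞 K) V) (u : p.adicCompletion K ⊗[K] V),
      u ∈ localLattice p M → baseChangeAut (p.adicCompletion K) h u ∈ localLattice p (h • M) :=
    fun h M u hu => baseChange_mem_localLattice p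
      (fun l hl => Submodule.smul_mem_pointwise_smul l h M hl) hu
  ext u
  rw [AddSubgroup.mem_pointwise_smul_iff_inv_smul_mem, ← map_inv]
  constructor
  · intro h
    have := key g L _ h
    rwa [LinearEquiv.smul_def, ← LinearEquiv.mul_apply, ← map_mul, mul_inv_cancel, map_one] at this
  · intro h
    have := key g⁻¹ _ _ h
    rwa [inv_smul_smul] at this

lemma IsLattice.smul {L : Submodule (𝓞 K) V} (hL : IsLattice K L) (g : V ≃ₗ[K] V) :
    IsLattice K (g • L) := by
  have h : g • L = L.map ((g : V →ₗ[K] V).restrictScalars (𝓞 K)) := rfl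
  refine ⟨h ▸ hL.1.map _, ?_⟩
  rw [h, Submodule.map_coe]
  have := congrArg (Submodule.map (g : V →ₗ[K] V)) hL.2
  rw [Submodule.map_span, Submodule.map_top, LinearEquiv.range] at this
  exact this

lemma infiniteLocalization_eq_univ (p : NumberField.InfinitePlace K) {L : Submodule (𝓞 K) V}
    (hL : IsLattice K L) (ν : V) : infiniteLocalization p L ν = Set.univ := by
  rw [Set.eq_univ_iff_forall]
  intro x
  refine ⟨x - 1 ⊗ₜ ν, ?_, by abel⟩
  generalize x - 1 ⊗ₜ ν = y
  induction y with
  | zero => exact zero_mem _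
  | add y z hy hz => exact add_mem hy hz
  | tmul c v =>
    have hv : v ∈ Submodule.span K (L : Set V) := hL.2 ▸ Submodule.mem_top
    induction hv using Submodule.span_induction generalizing c with
    | mem l hl =>
      have : c ⊗ₜ[K] l = (⟨c, trivial⟩ : (⊤ : Subring p.Completion)) •
          ((1 : p.Completion) ⊗ₜ[K] l) := by
        change _ = c • ((1 : p.Completion) ⊗ₜ[K] l)
        rw [TensorProduct.smul_tmul', smul_eq_mul, mul_one]
      rw [this]
      exact Submodule.smul_mem _ _ (Submodule.subset_span ⟨l, hl, rfl⟩)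
    | zero => simp
    | add v w _ _ hv hw => rw [TensorProduct.tmul_add]; exact add_mem (hv c) (hw c)
    | smul a v _ hv =>
      rw [← TensorProduct.smul_tmul]
      exact hv _

/-- Archimedean conditions are vacuous, since a lattice spans V and so its localization there is
everything. At a finite place, equality of cosets splits into equality of lattices and a congruence
for the shift vectors. -/
lemma mem_properGenus_iff {B : LinearMap.BilinForm K V} {L : Submodule (𝓞 K) V}
    (hL : IsLattice K L) {ν : V} {Y : Set V} :
    Y ∈ properGenus B L ν ↔ ∃ (M : Submodule (𝓞 K) V) (μ : V), IsLattice K M ∧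
      Y = coset M.toAddSubgroup μ ∧ ∀ p : HeightOneSpectrum (𝓞 K),
        ∃ σ ∈ properOrthogonalGroup (B.baseChange (p.adicCompletion K)),
          σ • (localLattice p L).toAddSubgroup = (localLattice p M).toAddSubgroup ∧
          σ (1 ⊗ₜ ν) - 1 ⊗ₜ μ ∈ localLattice p M := by
  have hfin : ∀ (M : Submodule (𝓞 K) V) (μ : V) (p : HeightOneSpectrum (𝓞 K)),
      finiteLocalization p M μ ∈
        properClass (B.baseChange (p.adicCompletion K)) (finiteLocalization p L ν) ↔
      ∃ σ ∈ properOrthogonalGroup (B.baseChange (p.adicCompletion K)),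
          σ • (localLattice p L).toAddSubgroup = (localLattice p M).toAddSubgroup ∧
          σ (1 ⊗ₜ ν) - 1 ⊗ₜ μ ∈ localLattice p M := by
    intro M μ p
    rw [mem_properClass_iff]
    refine exists_congr fun σ => and_congr_right fun _ => ?_
    rw [finiteLocalization_eq_coset, finiteLocalization_eq_coset, smul_coset, coset_eq_coset_iff]
    refine and_congr_right fun h => ?_
    rw [h]
    rfl
  refine exists_congr fun M => exists_congr fun μ => and_congr_right fun hM =>
    and_congr Iff.rfl ?_
  rw [and_iff_left, forall_congr' (hfin M μ)]
  intro p
  rw [infiniteLocalization_eq_univ p hM, infiniteLocalization_eq_univ p hL]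
  exact MulAction.mem_orbit_self _

lemma mem_properGenus_zero_iff [Module.Finite K V] {B : LinearMap.BilinForm K V}
    {L : Submodule (𝓞 K) V} (hL : IsLattice K L) {Y : Set V} :
    Y ∈ properGenus B L 0 ↔ ∃ M : Submodule (𝓞 K) V, IsLattice K M ∧ Y = M ∧
      ∀ p : HeightOneSpectrum (𝓞 K),
        ∃ σ ∈ properOrthogonalGroup (B.baseChange (p.adicCompletion K)),
          σ • (localLattice p L).toAddSubgroup = (localLattice p M).toAddSubgroup := by
  rw [mem_properGenus_iff hL]
  constructor
  · rintro ⟨M, μ, hM, rfl, h⟩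
    refine ⟨M, hM, ?_, fun p => ?_⟩
    · have hμ : μ ∈ M := mem_of_forall_tmul_mem_localLattice hM fun p => by
        obtain ⟨σ, -, -, h⟩ := h p
        simpa using h
      rw [← M.coe_toAddSubgroup, ← coset_zero, coset_eq_coset_iff]
      simpa using hμ
    · obtain ⟨σ, hσ, h, -⟩ := h p
      exact ⟨σ, hσ, h⟩
  · rintro ⟨M, hM, rfl, h⟩
    refine ⟨M, 0, hM, (coset_zero M.toAddSubgroup).symm, fun p => ?_⟩
    obtain ⟨σ, hσ, h⟩ := h p
    exact ⟨σ, hσ, h, by simp⟩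

lemma conductor_ne_bot [Module.Finite K V] {L : Submodule (𝓞 K) V} (hL : IsLattice K L) (ν : V) :
    conductor L ν ≠ ⊥ := by
  obtain ⟨b, hb⟩ := hL.exists_basis
  obtain ⟨d, hd, h⟩ := exists_smul_mem_of_basis b hb ν
  exact fun hbot => hd (Ideal.mem_bot.1 (hbot ▸ (h : d ∈ conductor L ν)))

lemma finite_setOf_dvd_conductor [Module.Finite K V] {L : Submodule (𝓞 K) V} (hL : IsLattice K L)
    (ν : V) : {p : HeightOneSpectrum (𝓞 K) | p.asIdeal ∣ conductor L ν}.Finite :=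
  Ideal.finite_factors (conductor_ne_bot hL ν)

/-- An element of the conductor outside p is a p-adic unit. This confines the whole problem to the
places dividing the conductor. -/
lemma tmul_mem_localLattice_of_not_dvd {L : Submodule (𝓞 K) V} {ν : V}
    {p : HeightOneSpectrum (𝓞 K)} (hp : ¬ p.asIdeal ∣ conductor L ν) :
    1 ⊗ₜ ν ∈ localLattice p L := by
  obtain ⟨a, ha, hap⟩ := SetLike.not_le_iff_exists.1 fun h => hp (Ideal.dvd_iff_le.2 h)
  have h1 : p.valuation K (algebraMap (𝓞 K) K a) = 1 := p.valuation_eq_one_iff_notMem.2 hap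
  have ha0 : algebraMap (𝓞 K) K a ≠ 0 := by
    rintro h
    simp [h] at h1
  have h2 := smul_mem_localLattice p (c := algebraMap K (p.adicCompletion K)
    (algebraMap (𝓞 K) K a)⁻¹) (by
      rw [mem_adicCompletionIntegers_algebraMap_iff, map_inv₀, h1, inv_one])
    (tmul_mem_localLattice p (show a • ν ∈ L from ha))
  rwa [algebraMap_smul, ← TensorProduct.tmul_smul, ← algebraMap_smul K a ν,
    inv_smul_smul₀ ha0] at h2

lemma tmul_integer_smul (p : HeightOneSpectrum (𝓞 K)) (d : 𝓞 K) (v : V) :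
    (1 : p.adicCompletion K) ⊗ₜ[K] (d • v) =
      algebraMap K (p.adicCompletion K) (algebraMap (𝓞 K) K d) • 1 ⊗ₜ v := by
  rw [← algebraMap_smul K d v, TensorProduct.tmul_smul,
    algebraMap_smul (p.adicCompletion K) (algebraMap (𝓞 K) K d)]

lemma mem_properStabilizer_finiteLocalization {B : LinearMap.BilinForm K V}
    {L : Submodule (𝓞 K) V} {ν : V} {p : HeightOneSpectrum (𝓞 K)}
    {σ : p.adicCompletion K ⊗[K] V ≃ₗ[p.adicCompletion K] p.adicCompletion K ⊗[K] V} :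
    σ ∈ properStabilizer (B.baseChange (p.adicCompletion K)) (finiteLocalization p L ν) ↔
      σ ∈ properOrthogonalGroup (B.baseChange (p.adicCompletion K)) ∧
      σ • (localLattice p L).toAddSubgroup = (localLattice p L).toAddSubgroup ∧
      σ (1 ⊗ₜ ν) - 1 ⊗ₜ ν ∈ localLattice p L := by
  rw [finiteLocalization_eq_coset]
  exact mem_properStabilizer_coset

lemma localIndex_ne_zero [Module.Finite K V] {B : LinearMap.BilinForm K V}
    {L : Submodule (𝓞 K) V} (hL : IsLattice K L) (ν : V) (p : HeightOneSpectrum (𝓞 K)) :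
    localIndex B L ν p ≠ 0 := by
  obtain ⟨b, hb⟩ := hL.exists_basis
  obtain ⟨d, hd, hdν⟩ := exists_smul_mem_of_basis b hb ν
  have hdK : algebraMap (𝓞 K) K d ≠ 0 := by simpa using hd
  let G := properStabilizer (B.baseChange (p.adicCompletion K)) (finiteLocalization p L 0)
  let f : V → Set (p.adicCompletion K ⊗[K] V) := fun v =>
    coset (localLattice p L).toAddSubgroup (1 ⊗ₜ v)
  have hfin : (f '' {v | d • v ∈ L}).Finite := by
    refine finite_image_setOf_smul_mem hL.1 hd (fun v w h => ?_) f fun v w h => ?_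
    · simp only [← algebraMap_smul K d] at h
      exact smul_right_injective _ hdK h
    · refine coset_eq_coset_iff.2 ⟨rfl, ?_⟩
      rw [← TensorProduct.tmul_sub]
      exact tmul_mem_localLattice p h
  -- By orbit-stabilizer the index is an orbit length. Each σν is congruent mod L_p to a global v
  -- integral away from p, and d kills v modulo L because it kills ν and σ preserves L_p; so the
  -- orbit sits among the finitely many cosets coming from d⁻¹L/L.
  have horb : MulAction.orbit G (finiteLocalization p L ν) ⊆ f '' {v | d • v ∈ L} := by
    rintro _ ⟨⟨σ, hσ⟩, rfl⟩
    obtain ⟨-, hσL, -⟩ := mem_properStabilizer_finiteLocalization.1 hσ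
    obtain ⟨v, hv, hv'⟩ := exists_tmul_sub_mem_and_forall_ne hL p (σ (1 ⊗ₜ ν))
    refine ⟨v, mem_of_forall_tmul_mem_localLattice hL fun q => ?_, ?_⟩
    · rw [tmul_integer_smul]
      by_cases hq : q = p
      · subst hq
        rw [← sub_add_cancel (1 ⊗ₜ v) (σ (1 ⊗ₜ ν)), smul_add, ← map_smul, ← tmul_integer_smul]
        refine add_mem (smul_mem_localLattice q ?_ hv) ?_
        · rw [mem_adicCompletionIntegers_algebraMap_iff]
          exact q.valuation_le_one d
        · exact hσL.le (AddSubgroup.smul_mem_pointwise_smul _ σ _ (tmul_mem_localLattice q hdν))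
      · refine smul_mem_localLattice q ?_ (hv' q hq)
        rw [mem_adicCompletionIntegers_algebraMap_iff]
        exact q.valuation_le_one d
    · change _ = σ • finiteLocalization p L ν
      rw [finiteLocalization_eq_coset, smul_coset, hσL]
      exact coset_eq_coset_iff.2 ⟨rfl, hv⟩
  have hidx : (properStabilizer (B.baseChange (p.adicCompletion K))
      (finiteLocalization p L ν)).subgroupOf G = MulAction.stabilizer G (finiteLocalization p L ν) := by
    ext ⟨σ, hσ⟩
    rw [Subgroup.mem_subgroupOf, MulAction.mem_stabilizer_iff, properStabilizer, Subgroup.mem_inf,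
      MulAction.mem_stabilizer_iff]
    exact and_iff_right hσ.1
  rw [localIndex, Subgroup.relIndex, hidx, MulAction.index_stabilizer]
  have := (hfin.subset horb)
  exact (Set.ncard_pos this).2 (MulAction.nonempty_orbit _) |>.ne'

end Genus
-- Two counting principles for group indices.
section Index

lemma index_pi_eq_prod {ι : Type*} [Fintype ι] {G : ι → Type*} [∀ i, Group (G i)]
    (H : ∀ i, Subgroup (G i)) : (Subgroup.pi Set.univ H).index = ∏ i, (H i).index := by
  simp_rw [Subgroup.index, ← Nat.card_pi]
  refine Nat.card_congr
    ((Quotient.congrRight (fun x y ↦ ?_)).trans (Setoid.piQuotientEquiv _).symm)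
  rw [QuotientGroup.leftRel_pi]

/-- `Ψ` induces a bijection from α × G/N. No finiteness is needed, as `Nat.card` is multiplicative
with infinite sets counted as 0. -/
lemma natCard_eq_mul_index {α β G : Type*} [Group G] (N : Subgroup G) (Ψ : α × G → β)
    (hΨ : Function.Surjective Ψ)
    (hiff : ∀ a g a' g', Ψ (a, g) = Ψ (a', g') ↔ a = a' ∧ g⁻¹ * g' ∈ N) :
    Nat.card β = Nat.card α * N.index := by
  rw [Subgroup.index, ← Nat.card_prod]
  refine (Nat.card_congr (Equiv.ofBijective
    (fun x : α × (G ⧸ N) => Ψ (x.1, x.2.out)) ⟨?_, fun b => ?_⟩)).symm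
  · rintro ⟨a, q⟩ ⟨a', q'⟩ h
    obtain ⟨h1, h2⟩ := (hiff _ _ _ _).1 h
    rw [← QuotientGroup.eq, QuotientGroup.out_eq', QuotientGroup.out_eq'] at h2
    exact Prod.ext h1 h2
  · obtain ⟨⟨a, g⟩, rfl⟩ := hΨ b
    refine ⟨(a, (g : G ⧸ N)), (hiff _ _ _ _).2 ⟨rfl, ?_⟩⟩
    rw [← QuotientGroup.eq, QuotientGroup.out_eq']

end Index

/-! ### Products of local stabilizers and the subgroup governing the classes. -/

section ClassNumber

variable {K V : Type*} [Field K] [NumberField K] [AddCommGroup V] [Module K V] [Module (𝓞 K) V]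
  [IsScalarTower (𝓞 K) K V]

lemma mem_properStabilizer_lattice {B : LinearMap.BilinForm K V} {L : Submodule (𝓞 K) V}
    {g : V ≃ₗ[K] V} : g ∈ properStabilizer B (L : Set V) ↔
      g ∈ properOrthogonalGroup B ∧ g • L = L := by
  rw [properStabilizer, Subgroup.mem_inf, MulAction.mem_stabilizer_iff,
    ← Submodule.coe_pointwise_smul, SetLike.coe_set_eq]

lemma mem_properStabilizer_shift {B : LinearMap.BilinForm K V} {L : Submodule (𝓞 K) V} {ν : V}
    {g : V ≃ₗ[K] V} : g ∈ properStabilizer B (shift L ν) ↔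
      g ∈ properStabilizer B (L : Set V) ∧ g ν - ν ∈ L := by
  rw [shift_eq_coset, mem_properStabilizer_coset, mem_properStabilizer_lattice, and_assoc,
    ← Submodule.pointwise_smul_toAddSubgroup, Submodule.toAddSubgroup_inj]
  rfl

lemma smul_eq_iff_forall_localLattice [Module.Finite K V] {L M : Submodule (𝓞 K) V}
    (hL : IsLattice K L) (hM : IsLattice K M) (g : V ≃ₗ[K] V) :
    g • L = M ↔ ∀ p : HeightOneSpectrum (𝓞 K), baseChangeAut (p.adicCompletion K) g •
      (localLattice p L).toAddSubgroup = (localLattice p M).toAddSubgroup := by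
  constructor
  · rintro rfl p
    exact smul_localLattice p g L
  · intro h
    refine eq_of_forall_localLattice_eq (hL.smul g) hM fun p => ?_
    rw [← smul_localLattice, h]

/-- The product of the local stabilizers `O⁺(L_p)` over the places in `S`. -/
abbrev LocalStabilizers (B : LinearMap.BilinForm K V) (L : Submodule (𝓞 K) V)
    (S : Finset (HeightOneSpectrum (𝓞 K))) : Type _ :=
  ∀ p : S, properStabilizer (B.baseChange (p.1.adicCompletion K)) (finiteLocalization p.1 L 0)

/-- The product of the groups `O⁺(L_p + ν)` over the places in `S`. -/
noncomputable def shiftStabilizers (B : LinearMap.BilinForm K V) (L : Submodule (𝓞 K) V) (ν : V)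
    (S : Finset (HeightOneSpectrum (𝓞 K))) : Subgroup (LocalStabilizers B L S) :=
  Subgroup.pi Set.univ fun p : S =>
    (properStabilizer (B.baseChange (p.1.adicCompletion K))
      (finiteLocalization p.1 L ν)).subgroupOf _

lemma mem_shiftStabilizers {B : LinearMap.BilinForm K V} {L : Submodule (𝓞 K) V} {ν : V}
    {S : Finset (HeightOneSpectrum (𝓞 K))} {u : LocalStabilizers B L S} :
    u ∈ shiftStabilizers B L ν S ↔
      ∀ p : S, (u p).1 (1 ⊗ₜ ν) - 1 ⊗ₜ ν ∈ localLattice p.1 L := by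
  rw [shiftStabilizers, Subgroup.mem_pi]
  simp only [Set.mem_univ, true_imp_iff]
  refine forall_congr' fun p => ?_
  have h := mem_properStabilizer_finiteLocalization.1 (u p).2
  rw [Subgroup.mem_subgroupOf, mem_properStabilizer_finiteLocalization, and_iff_right h.1,
    and_iff_right h.2.1]

lemma index_shiftStabilizers (B : LinearMap.BilinForm K V) (L : Submodule (𝓞 K) V) (ν : V)
    (S : Finset (HeightOneSpectrum (𝓞 K))) :
    (shiftStabilizers B L ν S).index = ∏ p ∈ S, localIndex B L ν p := by
  rw [shiftStabilizers, index_pi_eq_prod, ← Finset.prod_coe_sort S fun p => localIndex B L ν p]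
  rfl

lemma baseChangeAut_mem_properStabilizer (hdim : Module.finrank K V = 2)
    {B : LinearMap.BilinForm K V} {L : Submodule (𝓞 K) V} {g : V ≃ₗ[K] V}
    (hg : g ∈ properStabilizer B (L : Set V)) (p : HeightOneSpectrum (𝓞 K)) :
    baseChangeAut (p.adicCompletion K) g ∈
      properStabilizer (B.baseChange (p.adicCompletion K)) (finiteLocalization p L 0) := by
  rw [mem_properStabilizer_lattice] at hg
  rw [mem_properStabilizer_finiteLocalization]
  exact ⟨baseChangeAut_mem _ hdim hg.1, by rw [smul_localLattice, hg.2], by simp⟩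

/-- The diagonal homomorphism from `O⁺(L)` to the product of the `O⁺(L_p)`. -/
noncomputable def diagonal (hdim : Module.finrank K V = 2) (B : LinearMap.BilinForm K V)
    (L : Submodule (𝓞 K) V) (S : Finset (HeightOneSpectrum (𝓞 K))) :
    properStabilizer B (L : Set V) →* LocalStabilizers B L S :=
  MonoidHom.pi fun p => ((baseChangeAut (p.1.adicCompletion K)).comp
    (Subgroup.subtype _)).codRestrict _ fun g => baseChangeAut_mem_properStabilizer hdim g.2 p.1

lemma diagonal_apply (hdim : Module.finrank K V = 2) (B : LinearMap.BilinForm K V)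
    (L : Submodule (𝓞 K) V) (S : Finset (HeightOneSpectrum (𝓞 K)))
    (g : properStabilizer B (L : Set V)) (p : S) :
    (diagonal hdim B L S g p).1 = baseChangeAut (p.1.adicCompletion K) g.1 := rfl

lemma mul_comm_of_mem_baseChange (hdim : Module.finrank K V = 2) {B : LinearMap.BilinForm K V}
    (hsymm : B.IsSymm) (hB : B ≠ 0) (p : HeightOneSpectrum (𝓞 K))
    {σ τ : p.adicCompletion K ⊗[K] V ≃ₗ[p.adicCompletion K] p.adicCompletion K ⊗[K] V}
    (hσ : σ ∈ properOrthogonalGroup (B.baseChange (p.adicCompletion K)))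
    (hτ : τ ∈ properOrthogonalGroup (B.baseChange (p.adicCompletion K))) : σ * τ = τ * σ :=
  mul_comm_of_mem (by rw [Module.finrank_baseChange, hdim]) (LinearMap.BilinForm.isSymm_iff.2
    (LinearMap.BilinForm.IsSymm.baseChange _ (LinearMap.BilinForm.isSymm_iff.1 hsymm)))
    (by rwa [Ne, LinearMap.BilinForm.baseChange_eq_zero_iff]) hσ hτ

lemma localStabilizers_mul_comm (hdim : Module.finrank K V = 2) {B : LinearMap.BilinForm K V}
    (hsymm : B.IsSymm) (hB : B ≠ 0) {L : Submodule (𝓞 K) V}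
    {S : Finset (HeightOneSpectrum (𝓞 K))} (u w : LocalStabilizers B L S) : u * w = w * u := by
  ext p : 2
  exact mul_comm_of_mem_baseChange hdim hsymm hB p.1 (u p).2.1 (w p).2.1

lemma normal_shiftStabilizers (hdim : Module.finrank K V = 2) {B : LinearMap.BilinForm K V}
    (hsymm : B.IsSymm) (hB : B ≠ 0) (L : Submodule (𝓞 K) V) (ν : V)
    (S : Finset (HeightOneSpectrum (𝓞 K))) : (shiftStabilizers B L ν S).Normal :=
  ⟨fun n hn g => by rwa [localStabilizers_mul_comm hdim hsymm hB g, mul_inv_cancel_right]⟩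

variable [Module.Finite K V]

/-- The places dividing the conductor of `L + ν`. -/
noncomputable def conductorPlaces {L : Submodule (𝓞 K) V} (hL : IsLattice K L) (ν : V) :
    Finset (HeightOneSpectrum (𝓞 K)) :=
  (finite_setOf_dvd_conductor hL ν).toFinset

lemma tmul_mem_of_notMem_conductorPlaces {L : Submodule (𝓞 K) V} (hL : IsLattice K L) {ν : V}
    {p : HeightOneSpectrum (𝓞 K)} (hp : p ∉ conductorPlaces hL ν) : 1 ⊗ₜ ν ∈ localLattice p L :=
  tmul_mem_localLattice_of_not_dvd (by simpa [conductorPlaces] using hp)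

/-- gν - ν ∈ L may be tested locally, and away from the conductor it is automatic: there ν ∈ L_p and
g preserves L_p. -/
lemma comap_diagonal (hdim : Module.finrank K V = 2) (B : LinearMap.BilinForm K V)
    {L : Submodule (𝓞 K) V} (hL : IsLattice K L) (ν : V) :
    (shiftStabilizers B L ν (conductorPlaces hL ν)).comap
      (diagonal hdim B L (conductorPlaces hL ν)) =
      (properStabilizer B (shift L ν)).subgroupOf (properStabilizer B (L : Set V)) := by
  ext g
  rw [Subgroup.mem_comap, Subgroup.mem_subgroupOf, mem_properStabilizer_shift,
    and_iff_right g.2, mem_shiftStabilizers]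
  simp only [diagonal_apply, baseChangeAut_tmul, ← TensorProduct.tmul_sub]
  refine ⟨fun h => mem_of_forall_tmul_mem_localLattice hL fun p => ?_,
    fun h p => tmul_mem_localLattice p.1 h⟩
  by_cases hp : p ∈ conductorPlaces hL ν
  · exact h ⟨p, hp⟩
  · have h1 := tmul_mem_of_notMem_conductorPlaces hL hp
    rw [TensorProduct.tmul_sub]
    refine sub_mem ?_ h1
    have := (mem_properStabilizer_finiteLocalization.1
      (baseChangeAut_mem_properStabilizer hdim g.2 p)).2.1
    have h2 := AddSubgroup.smul_mem_pointwise_smul _ (baseChangeAut (p.adicCompletion K) g.1)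
      (localLattice p L).toAddSubgroup h1
    rwa [this] at h2

/-- The subgroup of the product of the `O⁺(L_p)` generated by `O⁺(L)` and the `O⁺(L_p + ν)`. -/
noncomputable def classSubgroup (hdim : Module.finrank K V = 2) (B : LinearMap.BilinForm K V)
    {L : Submodule (𝓞 K) V} (hL : IsLattice K L) (ν : V) :
    Subgroup (LocalStabilizers B L (conductorPlaces hL ν)) :=
  (diagonal hdim B L (conductorPlaces hL ν)).range ⊔ shiftStabilizers B L ν (conductorPlaces hL ν)

/-- Let D be the diagonal image of O⁺(L) and N the product of the O⁺(X_p) inside G = ∏ O⁺(L_p). Then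
[O⁺(L) : O⁺(X)] = [D : D ∩ N] = [DN : N], and [DN : N][G : DN] = [G : N]. -/
lemma globalIndex_mul_index_classSubgroup (hdim : Module.finrank K V = 2)
    {B : LinearMap.BilinForm K V} (hsymm : B.IsSymm) (hB : B ≠ 0) {L : Submodule (𝓞 K) V}
    (hL : IsLattice K L) (ν : V) :
    globalIndex B L ν * (classSubgroup hdim B hL ν).index =
      ∏ p ∈ conductorPlaces hL ν, localIndex B L ν p := by
  have := normal_shiftStabilizers hdim hsymm hB L ν (conductorPlaces hL ν)
  rw [← index_shiftStabilizers, globalIndex, Subgroup.relIndex, ← comap_diagonal hdim,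
    Subgroup.index_comap, ← Subgroup.relIndex_sup_right, classSubgroup,
    Subgroup.relIndex_mul_index le_sup_right]

lemma mem_classSubgroup (hdim : Module.finrank K V = 2) {B : LinearMap.BilinForm K V}
    (hsymm : B.IsSymm) (hB : B ≠ 0) {L : Submodule (𝓞 K) V} (hL : IsLattice K L) {ν : V}
    {u u' : LocalStabilizers B L (conductorPlaces hL ν)} :
    u⁻¹ * u' ∈ classSubgroup hdim B hL ν ↔ ∃ g ∈ properOrthogonalGroup B, g • L = L ∧
      ∀ p, baseChangeAut (p.1.adicCompletion K) g ((u' p).1 (1 ⊗ₜ ν)) - (u p).1 (1 ⊗ₜ ν) ∈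
        localLattice p.1 L := by
  have := normal_shiftStabilizers hdim hsymm hB L ν (conductorPlaces hL ν)
  have hcomm := localStabilizers_mul_comm hdim hsymm hB (L := L) (S := conductorPlaces hL ν)
  have key : ∀ g : properStabilizer B (L : Set V),
      (diagonal hdim B L _ g * (u⁻¹ * u') ∈ shiftStabilizers B L ν (conductorPlaces hL ν)) ↔
      ∀ p, baseChangeAut (p.1.adicCompletion K) g.1 ((u' p).1 (1 ⊗ₜ ν)) - (u p).1 (1 ⊗ₜ ν) ∈
        localLattice p.1 L := by
    intro g
    rw [← mul_assoc, hcomm _ u⁻¹, mul_assoc, mem_shiftStabilizers]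
    refine forall_congr' fun p => ?_
    have hu := (mem_properStabilizer_finiteLocalization.1 (u p).2).2.1
    have h1 : ((u⁻¹ * (diagonal hdim B L (conductorPlaces hL ν) g * u') :
        LocalStabilizers B L (conductorPlaces hL ν)) p).1 (1 ⊗ₜ ν) - 1 ⊗ₜ ν =
        (u p).1⁻¹ • (baseChangeAut (p.1.adicCompletion K) g.1 ((u' p).1 (1 ⊗ₜ ν)) -
          (u p).1 (1 ⊗ₜ ν)) := by
      rw [smul_sub, ← LinearEquiv.smul_def (u p).1 (1 ⊗ₜ ν), inv_smul_smul]
      rfl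
    rw [h1, ← Submodule.mem_toAddSubgroup, ← AddSubgroup.mem_pointwise_smul_iff_inv_smul_mem, hu,
      Submodule.mem_toAddSubgroup]
  rw [classSubgroup, Subgroup.mem_sup_of_normal_right]
  constructor
  · rintro ⟨_, ⟨g, rfl⟩, z, hz, h⟩
    have h2 := mem_properStabilizer_lattice.1 (g⁻¹).2
    -- From u⁻¹u' = diag(g)z with z in the shift stabilizers, the isometry wanted is g⁻¹.
    refine ⟨_, h2.1, h2.2, (key g⁻¹).1 ?_⟩
    rwa [← h, map_inv, inv_mul_cancel_left]
  · rintro ⟨g, hg, hgL, h⟩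
    have h2 := (key ⟨g, mem_properStabilizer_lattice.2 ⟨hg, hgL⟩⟩).2 h
    exact ⟨_, ⟨_, map_inv _ _⟩, _, h2, inv_mul_cancel_left _ _⟩

end ClassNumber
-- Classes of shifted lattices over a fixed lattice of the genus.
section ClassFormula

variable {K V : Type*} [Field K] [NumberField K] [AddCommGroup V] [Module K V] [Module (𝓞 K) V]
  [IsScalarTower (𝓞 K) K V] [Module.Finite K V]

/-- `M` lies in the proper genus of `L`, with local isometries `ρ`. -/
structure IsGenusFrame (B : LinearMap.BilinForm K V) (L M : Submodule (𝓞 K) V)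
    (ρ : ∀ p : HeightOneSpectrum (𝓞 K),
      p.adicCompletion K ⊗[K] V ≃ₗ[p.adicCompletion K] p.adicCompletion K ⊗[K] V) : Prop where
  isLattice : IsLattice K M
  mem : ∀ p, ρ p ∈ properOrthogonalGroup (B.baseChange (p.adicCompletion K))
  smul_eq : ∀ p, ρ p • (localLattice p L).toAddSubgroup = (localLattice p M).toAddSubgroup

variable {B : LinearMap.BilinForm K V} {L M : Submodule (𝓞 K) V}
  {ρ : ∀ p : HeightOneSpectrum (𝓞 K),
      p.adicCompletion K ⊗[K] V ≃ₗ[p.adicCompletion K] p.adicCompletion K ⊗[K] V}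

lemma IsGenusFrame.apply_mem_iff (h : IsGenusFrame B L M ρ) (p : HeightOneSpectrum (𝓞 K))
    {u : p.adicCompletion K ⊗[K] V} : ρ p u ∈ localLattice p M ↔ u ∈ localLattice p L := by
  rw [← Submodule.mem_toAddSubgroup, ← h.smul_eq]
  exact AddSubgroup.smul_mem_pointwise_smul_iff (a := ρ p)

/-- Since g commutes with ρ_p, it preserves ρ_p L_p iff it preserves L_p. Hence O⁺(M) = O⁺(L)
throughout the genus. -/
lemma IsGenusFrame.smul_eq_self_iff (hdim : Module.finrank K V = 2) (hsymm : B.IsSymm) (hB : B ≠ 0)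
    (hL : IsLattice K L) (h : IsGenusFrame B L M ρ) {g : V ≃ₗ[K] V}
    (hg : g ∈ properOrthogonalGroup B) : g • M = M ↔ g • L = L := by
  rw [smul_eq_iff_forall_localLattice h.isLattice h.isLattice,
    smul_eq_iff_forall_localLattice hL hL]
  refine forall_congr' fun p => ?_
  rw [← h.smul_eq p, smul_smul,
    mul_comm_of_mem_baseChange hdim hsymm hB p (baseChangeAut_mem _ hdim hg) (h.mem p), mul_smul,
    smul_left_cancel_iff]

/-- `M + μ` is the shifted lattice in the genus of `L + ν` whose localizations at the places
dividing the conductor are given by `ρ` and `u`. -/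
def IsTwist (hL : IsLattice K L) (ν : V) (M : Submodule (𝓞 K) V)
    (ρ : ∀ p : HeightOneSpectrum (𝓞 K),
      p.adicCompletion K ⊗[K] V ≃ₗ[p.adicCompletion K] p.adicCompletion K ⊗[K] V)
    (u : LocalStabilizers B L (conductorPlaces hL ν)) (μ : V) : Prop :=
  (∀ p : conductorPlaces hL ν, 1 ⊗ₜ μ - ρ p.1 ((u p).1 (1 ⊗ₜ ν)) ∈ localLattice p.1 M) ∧
    ∀ p ∉ conductorPlaces hL ν, 1 ⊗ₜ μ ∈ localLattice p M

lemma IsGenusFrame.exists_isTwist (h : IsGenusFrame B L M ρ) (hL : IsLattice K L) (ν : V)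
    (u : LocalStabilizers B L (conductorPlaces hL ν)) : ∃ μ, IsTwist hL ν M ρ u μ := by
  classical
  obtain ⟨μ, h1, h2⟩ := exists_forall_tmul_sub_mem h.isLattice (conductorPlaces hL ν)
    (fun p => if hp : p ∈ conductorPlaces hL ν then ρ p ((u ⟨p, hp⟩).1 (1 ⊗ₜ ν)) else 0)
  refine ⟨μ, fun p => ?_, h2⟩
  have := h1 p.1 p.2
  rwa [dif_pos p.2] at this

lemma IsGenusFrame.coset_mem_properGenus (h : IsGenusFrame B L M ρ) (hL : IsLattice K L) {ν : V}
    {u : LocalStabilizers B L (conductorPlaces hL ν)} {μ : V} (hμ : IsTwist hL ν M ρ u μ) :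
    coset M.toAddSubgroup μ ∈ properGenus B L ν := by
  rw [mem_properGenus_iff hL]
  refine ⟨M, μ, h.isLattice, rfl, fun p => ?_⟩
  by_cases hp : p ∈ conductorPlaces hL ν
  · obtain ⟨h1, h2, -⟩ := mem_properStabilizer_finiteLocalization.1 (u ⟨p, hp⟩).2
    refine ⟨ρ p * (u ⟨p, hp⟩).1, mul_mem (h.mem p) h1, by rw [mul_smul, h2, h.smul_eq], ?_⟩
    rw [← neg_mem_iff, neg_sub]
    exact hμ.1 ⟨p, hp⟩
  · refine ⟨ρ p, h.mem p, h.smul_eq p, sub_mem ?_ (hμ.2 p hp)⟩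
    exact (h.apply_mem_iff p).2 (tmul_mem_of_notMem_conductorPlaces hL hp)

/-- If σ_p takes L_p + ν to M_p + μ, then u_p = ρ_p⁻¹σ_p stabilizes L_p. -/
lemma IsGenusFrame.exists_isTwist_of_mem (h : IsGenusFrame B L M ρ) (hL : IsLattice K L) {ν μ : V}
    (hμ : ∀ p : HeightOneSpectrum (𝓞 K),
        ∃ σ ∈ properOrthogonalGroup (B.baseChange (p.adicCompletion K)),
          σ • (localLattice p L).toAddSubgroup = (localLattice p M).toAddSubgroup ∧
          σ (1 ⊗ₜ ν) - 1 ⊗ₜ μ ∈ localLattice p M) :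
    ∃ u : LocalStabilizers B L (conductorPlaces hL ν), IsTwist hL ν M ρ u μ := by
  choose σ hσ hσL hσμ using hμ
  have hmem : ∀ p, (ρ p)⁻¹ * σ p ∈ properStabilizer (B.baseChange (p.adicCompletion K))
      (finiteLocalization p L 0) := fun p => by
    rw [mem_properStabilizer_finiteLocalization]
    refine ⟨mul_mem (inv_mem (h.mem p)) (hσ p), ?_, by simp⟩
    rw [mul_smul, hσL, ← h.smul_eq, inv_smul_smul]
  refine ⟨fun p => ⟨_, hmem p.1⟩, fun p => ?_, fun p hp => ?_⟩
  · rw [← neg_mem_iff, neg_sub]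
    have : ρ p.1 (((ρ p.1)⁻¹ * σ p.1) (1 ⊗ₜ ν)) = σ p.1 (1 ⊗ₜ ν) := by
      rw [← LinearEquiv.mul_apply, mul_inv_cancel_left]
    rw [this]
    exact hσμ p.1
  · rw [← sub_sub_cancel (σ p (1 ⊗ₜ ν)) (1 ⊗ₜ μ)]
    refine sub_mem ?_ (hσμ p)
    have h2 := AddSubgroup.smul_mem_pointwise_smul _ (σ p) (localLattice p L).toAddSubgroup
      (tmul_mem_of_notMem_conductorPlaces hL hp)
    rwa [hσL] at h2

/-- At a conductor place, gμ' - μ ≡ gρ_p u'_p ν - ρ_p u_p ν = ρ_p(g u'_p ν - u_p ν) mod M_p, because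
g and ρ_p commute. At the other places both terms lie in M_p. -/
lemma IsGenusFrame.sub_mem_iff (hdim : Module.finrank K V = 2) (hsymm : B.IsSymm) (hB : B ≠ 0)
    (hL : IsLattice K L) (h : IsGenusFrame B L M ρ) {ν μ μ' : V}
    {u u' : LocalStabilizers B L (conductorPlaces hL ν)} (hμ : IsTwist hL ν M ρ u μ)
    (hμ' : IsTwist hL ν M ρ u' μ') {g : V ≃ₗ[K] V} (hg : g ∈ properOrthogonalGroup B)
    (hgL : g • L = L) : g μ' - μ ∈ M ↔ ∀ p : conductorPlaces hL ν,
      baseChangeAut (p.1.adicCompletion K) g ((u' p).1 (1 ⊗ₜ ν)) - (u p).1 (1 ⊗ₜ ν) ∈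
        localLattice p.1 L := by
  have hgM : g • M = M := (h.smul_eq_self_iff hdim hsymm hB hL hg).2 hgL
  have hgp : ∀ (p : HeightOneSpectrum (𝓞 K)) x, x ∈ localLattice p M →
      baseChangeAut (p.adicCompletion K) g x ∈ localLattice p M := fun p x hx => by
    have h2 := AddSubgroup.smul_mem_pointwise_smul _ (baseChangeAut (p.adicCompletion K) g)
      (localLattice p M).toAddSubgroup hx
    rwa [smul_localLattice, hgM] at h2
  have key : ∀ p : conductorPlaces hL ν, 1 ⊗ₜ (g μ' - μ) ∈ localLattice p.1 M ↔
      baseChangeAut (p.1.adicCompletion K) g ((u' p).1 (1 ⊗ₜ ν)) - (u p).1 (1 ⊗ₜ ν) ∈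
        localLattice p.1 L := by
    intro p
    rw [← h.apply_mem_iff p.1, map_sub]
    have hc : ρ p.1 (baseChangeAut (p.1.adicCompletion K) g ((u' p).1 (1 ⊗ₜ ν))) =
        baseChangeAut (p.1.adicCompletion K) g (ρ p.1 ((u' p).1 (1 ⊗ₜ ν))) :=
      DFunLike.congr_fun (mul_comm_of_mem_baseChange hdim hsymm hB p.1 (h.mem p.1)
        (baseChangeAut_mem _ hdim hg)) ((u' p).1 (1 ⊗ₜ ν))
    rw [hc]
    have h1 := hgp p.1 _ (hμ'.1 p)
    have h2 := hμ.1 p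
    rw [map_sub, baseChangeAut_tmul] at h1
    rw [← Submodule.sub_mem_iff_left _ (sub_mem h1 h2), TensorProduct.tmul_sub]
    convert Iff.rfl using 2
    abel
  constructor
  · exact fun hM p => (key p).1 (tmul_mem_localLattice p.1 hM)
  · intro hp
    refine mem_of_forall_tmul_mem_localLattice h.isLattice fun p => ?_
    by_cases hpS : p ∈ conductorPlaces hL ν
    · exact (key ⟨p, hpS⟩).2 (hp ⟨p, hpS⟩)
    · rw [TensorProduct.tmul_sub]
      exact sub_mem (hgp p _ (hμ'.2 p hpS)) (hμ.2 p hpS)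

lemma properClass_coset_eq_iff {M M' : Submodule (𝓞 K) V} {μ μ' : V} :
    properClass B (coset M.toAddSubgroup μ) = properClass B (coset M'.toAddSubgroup μ') ↔
      ∃ g ∈ properOrthogonalGroup B, g • M' = M ∧ g μ' - μ ∈ M := by
  rw [properClass_eq_iff]
  refine exists_congr fun g => and_congr_right fun _ => ?_
  rw [smul_coset, coset_eq_coset_iff, ← Submodule.pointwise_smul_toAddSubgroup,
    Submodule.toAddSubgroup_inj]
  refine and_congr_right fun h => ?_
  rw [h]
  rfl

lemma properClass_lattice_eq_iff {M M' : Submodule (𝓞 K) V} :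
    properClass B (M : Set V) = properClass B (M' : Set V) ↔
      ∃ g ∈ properOrthogonalGroup B, g • M' = M := by
  rw [properClass_eq_iff]
  refine exists_congr fun g => and_congr_right fun _ => ?_
  rw [← Submodule.coe_pointwise_smul, SetLike.coe_set_eq]

lemma natCard_properClasses (hdim : Module.finrank K V = 2) (hsymm : B.IsSymm) (hB : B ≠ 0)
    (hL : IsLattice K L) (ν : V) : Nat.card (properClasses B L ν) =
      Nat.card (properClasses B L 0) * (classSubgroup hdim B hL ν).index := by
  have hex : ∀ c : properClasses B L 0, ∃ M ρ, IsGenusFrame B L M ρ ∧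
      c.1 = properClass B (M : Set V) := by
    rintro ⟨_, Y, hY, rfl⟩
    obtain ⟨M, hM, rfl, h⟩ := (mem_properGenus_zero_iff hL).1 hY
    choose ρ hρ hρM using h
    exact ⟨M, ρ, ⟨hM, hρ, hρM⟩, rfl⟩
  choose M ρ hM hc using hex
  have hex2 := fun (x : properClasses B L 0 × LocalStabilizers B L (conductorPlaces hL ν)) =>
    (hM x.1).exists_isTwist hL ν x.2
  choose μ hμ using hex2
  refine natCard_eq_mul_index (classSubgroup hdim B hL ν)
    (fun x => ⟨properClass B (coset (M x.1).toAddSubgroup (μ x)),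
      _, (hM x.1).coset_mem_properGenus hL (hμ x), rfl⟩) ?_ ?_
  · rintro ⟨_, Y, hY, rfl⟩
    obtain ⟨N, η, hN, rfl, h⟩ := (mem_properGenus_iff hL).1 hY
    have hN0 : (N : Set V) ∈ properGenus B L 0 := by
      rw [mem_properGenus_zero_iff hL]
      refine ⟨N, hN, rfl, fun p => ?_⟩
      obtain ⟨σ, hσ, h, -⟩ := h p
      exact ⟨σ, hσ, h⟩
    let c : properClasses B L 0 := ⟨_, _, hN0, rfl⟩
    -- Move N to the chosen representative of its class; the image of the shift vector is then a
    -- twist by some u.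
    obtain ⟨g, hg, hgN⟩ := properClass_lattice_eq_iff.1 (hc c).symm
    obtain ⟨u, hu⟩ := (hM c).exists_isTwist_of_mem hL (ν := ν) (μ := g η) fun p => by
      obtain ⟨σ, hσ, hσL, hση⟩ := h p
      refine ⟨baseChangeAut _ g * σ, mul_mem (baseChangeAut_mem _ hdim hg) hσ, ?_, ?_⟩
      · rw [mul_smul, hσL, smul_localLattice, hgN]
      · have h2 := AddSubgroup.smul_mem_pointwise_smul _ (baseChangeAut (p.adicCompletion K) g)
          (localLattice p N).toAddSubgroup hση
        rw [smul_localLattice, hgN, LinearEquiv.smul_def, map_sub] at h2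
        exact h2
    refine ⟨(c, u), Subtype.ext ?_⟩
    refine properClass_coset_eq_iff.2 ⟨g, hg, hgN, ?_⟩
    -- With g = 1: two twists by the same u differ by an element of M.
    have h1 := ((hM c).sub_mem_iff hdim hsymm hB hL (hμ (c, u)) hu (one_mem _)
      (one_smul _ L)).2 fun p => by simp
    exact h1
  · intro c u c' u'
    refine (Subtype.ext_iff.trans properClass_coset_eq_iff).trans ?_
    rw [mem_classSubgroup hdim hsymm hB]
    constructor
    · rintro ⟨g, hg, hgM, h⟩
      have hcc : c = c' := by
        apply Subtype.ext
        rw [hc, hc]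
        exact properClass_lattice_eq_iff.2 ⟨g, hg, hgM⟩
      subst hcc
      have hgL := ((hM c).smul_eq_self_iff hdim hsymm hB hL hg).1 hgM
      exact ⟨rfl, g, hg, hgL,
        ((hM c).sub_mem_iff hdim hsymm hB hL (hμ (c, u)) (hμ (c, u')) hg hgL).1 h⟩
    · rintro ⟨rfl, g, hg, hgL, h⟩
      exact ⟨g, hg, ((hM c).smul_eq_self_iff hdim hsymm hB hL hg).2 hgL,
        ((hM c).sub_mem_iff hdim hsymm hB hL (hμ (c, u)) (hμ (c, u')) hg hgL).2 h⟩

end ClassFormula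
-- Determinants of maps between lattices of one genus are units.
lemma le_one_of_forall_mul_pow_le_one {Γ : Type*} [LinearOrderedCommGroupWithZero Γ]
    [MulArchimedean Γ] {x y : Γ} (hx : x ≠ 0) (h : ∀ n : ℕ, x * y ^ n ≤ 1) : y ≤ 1 := by
  by_contra! hy
  obtain ⟨n, hn⟩ := MulArchimedean.arch x⁻¹ hy
  have h1 := h (n + 1)
  rw [← le_inv_mul_iff₀ (zero_lt_iff.2 hx), mul_one] at h1
  exact absurd (h1.trans hn) (not_le.2 (pow_lt_pow_right₀ hy n.lt_succ_self))

section Determinant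

variable {K V : Type*} [Field K] [NumberField K] [AddCommGroup V] [Module K V] [Module (𝓞 K) V]
  [IsScalarTower (𝓞 K) K V] [Module.Finite K V]

lemma det_mem_of_smul_localLattice_eq {L : Submodule (𝓞 K) V} (hL : IsLattice K L)
    (p : HeightOneSpectrum (𝓞 K))
    {τ : p.adicCompletion K ⊗[K] V ≃ₗ[p.adicCompletion K] p.adicCompletion K ⊗[K] V}
    (hτ : τ • (localLattice p L).toAddSubgroup = (localLattice p L).toAddSubgroup) :
    LinearMap.det (τ : p.adicCompletion K ⊗[K] V →ₗ[p.adicCompletion K] _) ∈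
      p.adicCompletionIntegers K := by
  obtain ⟨b, hb⟩ := hL.exists_basis
  let F : Submodule (𝓞 K) V := Submodule.span (𝓞 K) (Set.range b)
  have hbF : ∀ i, b i ∈ F := fun i => Submodule.subset_span ⟨i, rfl⟩
  have hFrepr : ∀ l ∈ F, ∀ i, b.repr l i ∈ Set.range (algebraMap (𝓞 K) K) :=
    fun l hl i => (b.mem_span_iff_repr_mem (𝓞 K) l).1 hl i
  obtain ⟨d, hd, hdL⟩ := exists_forall_smul_mem (exists_smul_mem_of_basis b hbF) hL.1
  let bb := b.baseChange (p.adicCompletion K)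
  let c : p.adicCompletion K := algebraMap K (p.adicCompletion K) (algebraMap (𝓞 K) K d)
  have hc : c ≠ 0 := by simpa [c] using hd
  have hmem : ∀ n : ℕ, ∀ i, (τ ^ n) (bb i) ∈ localLattice p L := by
    intro n i
    have h1 : τ ^ n ∈ MulAction.stabilizer _ (localLattice p L).toAddSubgroup :=
      Subgroup.pow_mem _ (MulAction.mem_stabilizer_iff.2 hτ) n
    have h2 : bb i ∈ (localLattice p L).toAddSubgroup := by
      rw [Module.Basis.baseChange_apply]
      exact tmul_mem_localLattice p (hb i)
    have h3 := AddSubgroup.smul_mem_pointwise_smul _ (τ ^ n) _ h2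
    rwa [MulAction.mem_stabilizer_iff.1 h1] at h3
  -- The vectors c·τⁿ(b_i) have integral coordinates in b, and their determinant is c^r det(τ)ⁿ with
  -- r the dimension. Bounded powers force |det τ| ≤ 1.
  have hint : ∀ n : ℕ, c ^ (Module.finrank K V) *
      LinearMap.det (τ : p.adicCompletion K ⊗[K] V →ₗ[p.adicCompletion K] _) ^ n ∈
        p.adicCompletionIntegers K := by
    intro n
    have h1 : bb.det (fun i => c • (τ ^ n) (bb i)) = c ^ (Module.finrank K V) *
        LinearMap.det (τ : p.adicCompletion K ⊗[K] V →ₗ[p.adicCompletion K] _) ^ n := by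
      have h2 := bb.det_comp ((τ : p.adicCompletion K ⊗[K] V →ₗ[p.adicCompletion K] _) ^ n) bb
      rw [Module.Basis.det_self, mul_one, map_pow] at h2
      have h3 := bb.det.toMultilinearMap.map_smul_univ (fun _ => c) (fun i => (τ ^ n) (bb i))
      rw [Finset.prod_const, Finset.card_univ, Fintype.card_fin] at h3
      rw [← h2]
      refine h3.trans ?_
      have h5 : (fun i => (τ ^ n) (bb i)) =
          ⇑((τ : p.adicCompletion K ⊗[K] V →ₗ[p.adicCompletion K] _) ^ n) ∘ bb := by
        funext i
        rw [Function.comp_apply, LinearEquiv.pow_apply, Module.End.pow_apply]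
        rfl
      rw [smul_eq_mul, h5]
      rfl
    rw [← h1, Module.Basis.det_apply, Matrix.det_apply]
    refine sum_mem fun σ _ => ?_
    rw [Units.smul_def, zsmul_eq_mul]
    refine mul_mem (intCast_mem _ _) (prod_mem fun i _ => ?_)
    exact repr_mem_of_mem_localLattice b p hFrepr
      (smul_mem_localLattice_of_forall p hdL (hmem n i)) _
  rw [HeightOneSpectrum.mem_adicCompletionIntegers]
  refine le_one_of_forall_mul_pow_le_one (x := Valued.v (c ^ (Module.finrank K V))) ?_ fun n => ?_
  · rw [Valuation.ne_zero_iff]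
    exact pow_ne_zero _ hc
  · have h := hint n
    rwa [HeightOneSpectrum.mem_adicCompletionIntegers, Valuation.map_mul,
      Valuation.map_pow _ (LinearMap.det _)] at h

/-- At each p, ρ_p σ_p⁻¹ g stabilizes M_p and has the determinant of g, which is therefore integral
everywhere; the same holds for g⁻¹. -/
lemma exists_unit_det_eq {B : LinearMap.BilinForm K V} {L M N : Submodule (𝓞 K) V}
    {ρ σ : ∀ p : HeightOneSpectrum (𝓞 K),
      p.adicCompletion K ⊗[K] V ≃ₗ[p.adicCompletion K] p.adicCompletion K ⊗[K] V}
    (hM : IsGenusFrame B L M ρ) (hN : IsGenusFrame B L N σ) {g : V ≃ₗ[K] V} (hg : g • M = N) :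
    ∃ ε : (𝓞 K)ˣ, LinearMap.det (g : V →ₗ[K] V) = algebraMap (𝓞 K) K ε := by
  have key : ∀ {M N : Submodule (𝓞 K) V} {ρ σ : ∀ p : HeightOneSpectrum (𝓞 K),
      p.adicCompletion K ⊗[K] V ≃ₗ[p.adicCompletion K] p.adicCompletion K ⊗[K] V}
      (_ : IsGenusFrame B L M ρ) (_ : IsGenusFrame B L N σ) {g : V ≃ₗ[K] V} (_ : g • M = N),
      ∃ c : 𝓞 K, algebraMap (𝓞 K) K c = LinearMap.det (g : V →ₗ[K] V) := by
    intro M N ρ σ hM hN g hg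
    refine HeightOneSpectrum.mem_integers_of_valuation_le_one K _ fun p => ?_
    rw [← mem_adicCompletionIntegers_algebraMap_iff]
    have h1 : (ρ p * (σ p)⁻¹ * baseChangeAut (p.adicCompletion K) g) •
        (localLattice p M).toAddSubgroup = (localLattice p M).toAddSubgroup := by
      rw [mul_smul, mul_smul, smul_localLattice, hg, ← hN.smul_eq, inv_smul_smul, hM.smul_eq]
    have h2 := det_mem_of_smul_localLattice_eq hM.isLattice p h1
    have h3 := mul_mem (hM.mem p) (inv_mem (hN.mem p))
    have h4 : ((ρ p * (σ p)⁻¹ * baseChangeAut (p.adicCompletion K) g :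
        p.adicCompletion K ⊗[K] V ≃ₗ[p.adicCompletion K] p.adicCompletion K ⊗[K] V) :
        p.adicCompletion K ⊗[K] V →ₗ[p.adicCompletion K] p.adicCompletion K ⊗[K] V) =
        ((ρ p * (σ p)⁻¹ : p.adicCompletion K ⊗[K] V ≃ₗ[p.adicCompletion K]
          p.adicCompletion K ⊗[K] V) : _ →ₗ[p.adicCompletion K] _) ∘ₗ
          (g : V →ₗ[K] V).baseChange (p.adicCompletion K) := rfl
    rwa [h4, LinearMap.det_comp, h3.2, one_mul, LinearMap.det_baseChange] at h2
  obtain ⟨c, hc⟩ := key hM hN hg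
  obtain ⟨c', hc'⟩ := key hN hM (g := g⁻¹) (by rw [← hg, inv_smul_smul])
  have hcc : c * c' = 1 := by
    apply FaithfulSMul.algebraMap_injective (𝓞 K) K
    rw [map_mul, map_one, hc, hc', ← LinearMap.det_comp]
    have : (g : V →ₗ[K] V) ∘ₗ ((g⁻¹ : V ≃ₗ[K] V) : V →ₗ[K] V) = LinearMap.id := by
      ext x
      exact g.apply_symm_apply x
    rw [this, LinearMap.det_id]
  exact ⟨⟨c, c', hcc, by rwa [mul_comm]⟩, hc.symm⟩

end Determinant

/-! ### Ideal classes of submodules of a line over a number field. -/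

section ClassGroup

variable {E V : Type*} [Field E] [NumberField E] [AddCommGroup V] [Module E V] [Module (𝓞 E) V]
  [IsScalarTower (𝓞 E) E V]

lemma exists_smul_mem_iff_of_classGroup_mk_eq {I J : (FractionalIdeal (nonZeroDivisors (𝓞 E)) E)ˣ}
    (h : ClassGroup.mk E I = ClassGroup.mk E J) :
    ∃ a : Eˣ, ∀ x : E, x ∈ (I : FractionalIdeal (nonZeroDivisors (𝓞 E)) E) ↔
      a * x ∈ (J : FractionalIdeal (nonZeroDivisors (𝓞 E)) E) := by
  have h1 : J * I⁻¹ ∈ (toPrincipalIdeal (𝓞 E) E).range := by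
    have h1 : ClassGroup.mk E (J * I⁻¹) = 1 := by rw [map_mul, map_inv, h, mul_inv_cancel]
    rw [ClassGroup.mk_eq_one_iff, FractionalIdeal.isPrincipal_iff] at h1
    rw [mem_principal_ideals_iff]
    obtain ⟨x, hx⟩ := h1
    exact ⟨x, hx.symm⟩
  obtain ⟨a, ha⟩ := h1
  rw [eq_mul_inv_iff_mul_eq] at ha
  refine ⟨a, fun x => ?_⟩
  rw [← ha, Units.val_mul, coe_toPrincipalIdeal, FractionalIdeal.mem_singleton_mul]
  constructor
  · intro hx
    exact ⟨x, hx, rfl⟩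
  · rintro ⟨y, hy, hxy⟩
    rwa [mul_left_cancel₀ a.ne_zero hxy]

lemma exists_classGroup_map (hrank : Module.finrank E V = 1) :
    ∃ cl : Submodule (𝓞 E) V → ClassGroup (𝓞 E), ∀ I J : Submodule (𝓞 E) V,
      I.FG → I ≠ ⊥ → J.FG → J ≠ ⊥ → cl I = cl J → ∃ a : Eˣ, ∀ x, x ∈ I ↔ a • x ∈ J := by
  classical
  have : Module.Finite E V := Module.finite_of_finrank_eq_succ hrank
  let e : E ≃ₗ[E] V := LinearEquiv.ofFinrankEq E V (by rw [hrank, Module.finrank_self])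
  let e' : E ≃ₗ[𝓞 E] V := e.restrictScalars (𝓞 E)
  let frac : ∀ I : Submodule (𝓞 E) V, I.FG → FractionalIdeal (nonZeroDivisors (𝓞 E)) E :=
    fun I hI => ⟨I.map (e'.symm : V →ₗ[𝓞 E] E),
      FractionalIdeal.isFractional_of_fg (hI.map _)⟩
  have hmem : ∀ I hI x, x ∈ frac I hI ↔ e x ∈ I := by
    intro I hI x
    change x ∈ I.map (e'.symm : V →ₗ[𝓞 E] E) ↔ _
    rw [Submodule.mem_map_equiv]
    rfl
  have hne : ∀ I hI, I ≠ ⊥ → frac I hI ≠ 0 := by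
    intro I hI h h0
    obtain ⟨y, hy, hy0⟩ := I.ne_bot_iff.1 h
    have := (hmem I hI (e.symm y)).2 (by rwa [e.apply_symm_apply])
    rw [h0, FractionalIdeal.mem_zero_iff] at this
    exact hy0 (by simpa using this)
  -- An identification of V with E turns nonzero finitely generated submodules into fractional
  -- ideals; the value 1 elsewhere is never used.
  refine ⟨fun I => if h : I.FG ∧ I ≠ ⊥ then
    ClassGroup.mk E (Units.mk0 (frac I h.1) (hne I h.1 h.2)) else 1, ?_⟩
  intro I J hI hI0 hJ hJ0 h
  beta_reduce at h
  rw [dif_pos ⟨hI, hI0⟩, dif_pos ⟨hJ, hJ0⟩] at h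
  obtain ⟨a, ha⟩ := exists_smul_mem_iff_of_classGroup_mk_eq h
  refine ⟨a, fun x => ?_⟩
  have h2 := ha (e.symm x)
  rw [Units.val_mk0, Units.val_mk0, hmem I hI, hmem J hJ, e.apply_symm_apply, ← smul_eq_mul, map_smul,
    e.apply_symm_apply] at h2
  exact h2

end ClassGroup
-- Finiteness of the number of proper classes in the genus of L.
lemma finite_setOf_between {R M : Type*} [CommRing R] [Ring.HasFiniteQuotients R]
    [AddCommGroup M] [Module R M] {I : Submodule R M} (hI : I.FG) {d : R} (hd : d ≠ 0) :
    {N : Submodule R M | (∀ x ∈ I, d • x ∈ N) ∧ N ≤ I}.Finite := by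
  have := finite_quotient_span_smul_top hI hd
  rw [← Set.image_id {N : Submodule R M | (∀ x ∈ I, d • x ∈ N) ∧ N ≤ I}]
  refine finite_image_of_factor id (γ := Set (I ⧸ (Ideal.span {d} • (⊤ : Submodule R I))))
    (fun N => {q | ∃ x : I, (x : M) ∈ N ∧ Submodule.Quotient.mk x = q}) ?_
  -- A module between dI and I is determined by its image in the finite quotient I/dI.
  have key : ∀ N N' : Submodule R M, N ≤ I → (∀ x ∈ I, d • x ∈ N') →
      {q | ∃ x : I, (x : M) ∈ N ∧ Submodule.Quotient.mk x = q} ⊆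
      {q : I ⧸ (Ideal.span {d} • (⊤ : Submodule R I)) | ∃ x : I, (x : M) ∈ N' ∧
        Submodule.Quotient.mk x = q} → N ≤ N' := by
    intro N N' hN hN' h x hx
    obtain ⟨y, hy, hxy⟩ := h ⟨⟨x, hN hx⟩, hx, rfl⟩
    obtain ⟨z, hz, hyz⟩ := exists_sub_eq_smul_of_mk_eq hxy
    have h1 := sub_mem hy (hyz ▸ hN' z hz)
    simpa using h1
  intro N hN N' hN' h
  exact le_antisymm (key N N' hN.2 hN'.1 (le_of_eq h)) (key N' N hN'.2 hN.1 (ge_of_eq h))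

section Finiteness

variable {K E V : Type*} [Field K] [NumberField K] [Field E] [NumberField E] [Algebra K E]
  [AddCommGroup V] [Module K V] [Module (𝓞 K) V] [IsScalarTower (𝓞 K) K V]
  [Module E V] [IsScalarTower K E V] [Module (𝓞 E) V] [IsScalarTower (𝓞 E) E V]

instance isScalarTower_integers : IsScalarTower (𝓞 K) (𝓞 E) V where
  smul_assoc a b v := by
    have h : algebraMap (𝓞 E) E (a • b) =
        algebraMap (𝓞 K) K a • algebraMap (𝓞 E) E b := by
      rw [Algebra.smul_def, Algebra.smul_def, map_mul]
      rfl
    rw [← algebraMap_smul E (a • b) v, h, smul_assoc, algebraMap_smul, algebraMap_smul]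

lemma mem_smul_submodule_iff {g : V ≃ₗ[K] V} {M : Submodule (𝓞 K) V} {x : V} :
    x ∈ g • M ↔ g⁻¹ • x ∈ M := by
  rw [← Submodule.mem_toAddSubgroup, Submodule.pointwise_smul_toAddSubgroup,
    AddSubgroup.mem_pointwise_smul_iff_inv_smul_mem, Submodule.mem_toAddSubgroup]

/-- A Jordan–Zassenhaus argument in rank one: M lies between d·𝓞_E M and 𝓞_E M. Scaling by Eˣ makes
𝓞_E M one of finitely many modules, one per ideal class, and each leaves finitely many choices in
between. -/
lemma exists_finite_forall_exists_smul_mem (hrank : Module.finrank E V = 1)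
    {D : Set (Submodule (𝓞 K) V)} (hD : ∀ M ∈ D, M.FG ∧ M ≠ ⊥) {d : 𝓞 K} (hd : d ≠ 0)
    (hdD : ∀ M ∈ D, ∀ w : 𝓞 E, ∀ m ∈ M, d • w • m ∈ M) :
    ∃ T : Set (Submodule (𝓞 K) V), T.Finite ∧ ∀ M ∈ D, ∃ a : Eˣ, ∃ N ∈ T,
      DistribMulAction.toModuleAut K V a • N = M := by
  obtain ⟨cl, hcl⟩ := exists_classGroup_map (E := E) (V := V) hrank
  let sp : Submodule (𝓞 K) V → Submodule (𝓞 E) V := fun M => Submodule.span (𝓞 E) (M : Set V)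
  have hspFG : ∀ M ∈ D, (sp M).FG := fun M hM => by
    obtain ⟨s, hs⟩ := (hD M hM).1
    refine ⟨s, le_antisymm (Submodule.span_mono (hs ▸ Submodule.subset_span)) ?_⟩
    refine Submodule.span_le.2 fun x hx => ?_
    rw [← hs] at hx
    exact Submodule.span_subset_span (𝓞 K) (𝓞 E) _ hx
  have hspne : ∀ M ∈ D, sp M ≠ ⊥ := fun M hM h => (hD M hM).2 <| by
    rw [Submodule.eq_bot_iff]
    intro x hx
    exact (Submodule.eq_bot_iff _).1 h x (Submodule.subset_span hx)
  have hspd : ∀ M ∈ D, ∀ x ∈ sp M, d • x ∈ M := by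
    intro M hM x hx
    suffices h : ∀ w : 𝓞 E, d • w • x ∈ M by simpa using h 1
    induction hx using Submodule.span_induction with
    | mem x hx => exact fun w => hdD M hM w x hx
    | zero => simp
    | add x y _ _ hx hy => intro w; rw [smul_add, smul_add]; exact add_mem (hx w) (hy w)
    | smul w' x _ hx => intro w; rw [smul_smul w w' x]; exact hx _
  let Tc : ClassGroup (𝓞 E) → Set (Submodule (𝓞 K) V) := fun c =>
    {N | ∃ h : ∃ M ∈ D, cl (sp M) = c,
      (∀ x ∈ (sp h.choose).restrictScalars (𝓞 K), d • x ∈ N) ∧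
        N ≤ (sp h.choose).restrictScalars (𝓞 K)}
  refine ⟨⋃ c, Tc c, Set.finite_iUnion fun c => ?_, fun M hM => ?_⟩
  · by_cases h : ∃ M ∈ D, cl (sp M) = c
    · have hfg : ((sp h.choose).restrictScalars (𝓞 K)).FG :=
        (hspFG _ h.choose_spec.1).restrictScalars
      refine (finite_setOf_between hfg hd).subset ?_
      rintro N ⟨_, hN⟩
      exact hN
    · refine Set.finite_empty.subset ?_
      rintro N ⟨h', _⟩
      exact h h'
  · have h : ∃ M' ∈ D, cl (sp M') = cl (sp M) := ⟨M, hM, rfl⟩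
    obtain ⟨a, ha⟩ := hcl (sp M) (sp h.choose) (hspFG M hM) (hspne M hM)
      (hspFG _ h.choose_spec.1) (hspne _ h.choose_spec.1) h.choose_spec.2.symm
    refine ⟨a⁻¹, DistribMulAction.toModuleAut K V a • M,
      Set.mem_iUnion.2 ⟨_, h, fun x hx => ?_, ?_⟩, by rw [map_inv, inv_smul_smul]⟩
    · rw [mem_smul_submodule_iff, ← map_inv]
      have h1 := hspd M hM (a⁻¹ • x) ((ha _).2 (by rwa [smul_inv_smul]))
      change a⁻¹ • d • x ∈ M
      rwa [← algebraMap_smul K d, smul_comm, algebraMap_smul]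
    · intro x hx
      rw [mem_smul_submodule_iff, ← map_inv] at hx
      have h1 := (ha _).1 (Submodule.subset_span hx : a⁻¹ • x ∈ sp M)
      rwa [smul_inv_smul] at h1

variable [Module.Finite K V] {B : LinearMap.BilinForm K V} {L : Submodule (𝓞 K) V}

/-- The lattices in the proper genus of `L`. -/
def genusLattices (B : LinearMap.BilinForm K V) (L : Submodule (𝓞 K) V) :
    Set (Submodule (𝓞 K) V) := {M | ∃ ρ, IsGenusFrame B L M ρ}

/-- Choose d with d·𝓞_E L ⊆ L. Multiplication by dw is proper, hence commutes with ρ_p, so stability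
passes from L_p to M_p = ρ_p L_p with the same d for the whole genus. -/
lemma exists_forall_smul_smul_mem (hdim : Module.finrank K V = 2) (hsymm : B.IsSymm) (hB : B ≠ 0)
    (hL : IsLattice K L) (hE : ∀ z : E, IsProperEnd B (Algebra.lsmul K K V z)) :
    ∃ d : 𝓞 K, d ≠ 0 ∧ ∀ M ∈ genusLattices B L, ∀ w : 𝓞 E, ∀ m ∈ M, d • w • m ∈ M := by
  obtain ⟨b, hb⟩ := hL.exists_basis
  have hfg : ((Submodule.span (𝓞 E) (L : Set V)).restrictScalars (𝓞 K)).FG := by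
    refine Submodule.FG.restrictScalars ?_
    obtain ⟨s, hs⟩ := hL.1
    refine ⟨s, le_antisymm (Submodule.span_mono (hs ▸ Submodule.subset_span)) ?_⟩
    refine Submodule.span_le.2 fun x hx => ?_
    rw [← hs] at hx
    exact Submodule.span_subset_span (𝓞 K) (𝓞 E) _ hx
  obtain ⟨d, hd, hdL⟩ := exists_forall_smul_mem (exists_smul_mem_of_basis b hb) hfg
  refine ⟨d, hd, ?_⟩
  rintro M ⟨ρ, hρ⟩ w m hm
  have hact : ∀ v : V, Algebra.lsmul K K V (algebraMap (𝓞 K) K d • algebraMap (𝓞 E) E w) v =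
      d • w • v := fun v => by
    change (algebraMap (𝓞 K) K d • algebraMap (𝓞 E) E w) • v = _
    rw [smul_assoc, algebraMap_smul, algebraMap_smul]
  refine mem_of_forall_tmul_mem_localLattice hρ.isLattice fun p => ?_
  let A : Module.End K V := Algebra.lsmul K K V (algebraMap (𝓞 K) K d • algebraMap (𝓞 E) E w)
  have h1 : (1 : p.adicCompletion K) ⊗ₜ[K] m ∈ ρ p • (localLattice p L).toAddSubgroup := by
    rw [hρ.smul_eq]
    exact tmul_mem_localLattice p hm
  obtain ⟨y, hy, hym⟩ := h1
  have hcomm := ((hE _).baseChange (p.adicCompletion K) : IsProperEnd _ (A.baseChange _)).commute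
    (by rw [Module.finrank_baseChange, hdim]) (LinearMap.BilinForm.isSymm_iff.2
    (LinearMap.BilinForm.IsSymm.baseChange _ (LinearMap.BilinForm.isSymm_iff.1 hsymm)))
    (by rwa [Ne, LinearMap.BilinForm.baseChange_eq_zero_iff])
    (isProperEnd_of_mem (by rw [Module.finrank_baseChange, hdim]) (hρ.mem p))
  have h2 : (1 : p.adicCompletion K) ⊗ₜ[K] (d • w • m) =
      ρ p (A.baseChange (p.adicCompletion K) y) := by
    rw [← hact, ← LinearMap.baseChange_tmul, ← hym]
    exact DFunLike.congr_fun hcomm y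
  rw [h2, hρ.apply_mem_iff]
  refine baseChange_mem_localLattice p (fun l hl => ?_) hy
  rw [hact]
  exact hdL _ (Submodule.smul_mem _ w (Submodule.subset_span hl))

lemma det_algebraMap_eq_sq (hdim : Module.finrank K V = 2) (c : K) :
    LinearMap.det (Algebra.lsmul K K V (algebraMap K E c)) = c ^ 2 := by
  have : (Algebra.lsmul K K V (algebraMap K E c) : V →ₗ[K] V) = c • LinearMap.id := by
    ext v
    simp
  rw [this, LinearMap.det_smul, hdim, LinearMap.det_id, mul_one]

/-- Relative to a base point a₁N of the genus, each multiplier a/a₁ has unit determinant. If two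
such units agree modulo squares, the multipliers differ, up to a unit η of 𝓞 K, by an element of
determinant 1, which is an isometry. Scaling by η fixes every lattice and has determinant η². -/
lemma finite_image_properClass_of_smul (hdim : Module.finrank K V = 2)
    (hE : ∀ z : E, IsProperEnd B (Algebra.lsmul K K V z)) (N : Submodule (𝓞 K) V) :
    ((fun a : Eˣ => properClass B
      ((DistribMulAction.toModuleAut K V a • N : Submodule (𝓞 K) V) : Set V)) ''
        {a | DistribMulAction.toModuleAut K V a • N ∈ genusLattices B L}).Finite := by
  classical
  rcases Set.eq_empty_or_nonempty
    {a : Eˣ | DistribMulAction.toModuleAut K V a • N ∈ genusLattices B L} with h | ⟨a₁, ρ₁, h₁⟩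
  · rw [h, Set.image_empty]
    exact Set.finite_empty
  have : Finite ((𝓞 K)ˣ ⧸ (powMonoidHom (α := (𝓞 K)ˣ) 2).range) := by
    have : Group.FG (𝓞 K)ˣ := Group.fg_iff_monoid_fg.2 inferInstance
    have := Subgroup.finiteIndex_range_powMonoidHom_of_fg (𝓞 K)ˣ two_ne_zero
    exact Subgroup.finiteIndex_iff_finite_quotient.1 this
  have hunit : ∀ a : Eˣ, DistribMulAction.toModuleAut K V a • N ∈ genusLattices B L →
      ∃ ε : (𝓞 K)ˣ, LinearMap.det (Algebra.lsmul K K V ((a * a₁⁻¹ : Eˣ) : E)) =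
        algebraMap (𝓞 K) K ε := by
    rintro a ⟨ρ, h⟩
    refine exists_unit_det_eq h₁ h (g := DistribMulAction.toModuleAut K V (a * a₁⁻¹)) ?_
    rw [smul_smul, ← map_mul, inv_mul_cancel_right]
  refine finite_image_of_factor _ (γ := (𝓞 K)ˣ ⧸ (powMonoidHom (α := (𝓞 K)ˣ) 2).range)
    (fun a => if h : DistribMulAction.toModuleAut K V a • N ∈ genusLattices B L then
      ((hunit a h).choose : (𝓞 K)ˣ ⧸ (powMonoidHom (α := (𝓞 K)ˣ) 2).range) else 1) ?_
  intro a ha a' ha' h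
  rw [Set.mem_ofPred_eq] at ha ha'
  beta_reduce at h
  rw [dif_pos ha, dif_pos ha', QuotientGroup.eq] at h
  have hε := (hunit a ha).choose_spec
  have hε' := (hunit a' ha').choose_spec
  generalize (hunit a ha).choose = ε at h hε
  generalize (hunit a' ha').choose = ε' at h hε'
  obtain ⟨η, hη⟩ := h
  rw [powMonoidHom_apply, eq_inv_mul_iff_mul_eq] at hη
  let ηE : Eˣ := Units.map (algebraMap K E : K →* E) (Units.map (algebraMap (𝓞 K) K : 𝓞 K →* K) η)
  have hdet : ∀ x y : E, LinearMap.det (Algebra.lsmul K K V (x * y)) =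
      LinearMap.det (Algebra.lsmul K K V x) * LinearMap.det (Algebra.lsmul K K V y) :=
    fun x y => by rw [map_mul, ← LinearMap.det_comp]; rfl
  have hηdet : LinearMap.det (Algebra.lsmul K K V (ηE : E)) = (algebraMap (𝓞 K) K η) ^ 2 :=
    det_algebraMap_eq_sq hdim _
  have hηN : ∀ M : Submodule (𝓞 K) V, DistribMulAction.toModuleAut K V ηE • M = M := by
    intro M
    ext x
    have hx : (DistribMulAction.toModuleAut K V ηE)⁻¹ • x = ((η⁻¹ : (𝓞 K)ˣ) : 𝓞 K) • x := by
      rw [← map_inv, ← algebraMap_smul K, ← algebraMap_smul E]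
      rfl
    rw [mem_smul_submodule_iff, hx]
    refine ⟨fun h => ?_, fun h => M.smul_mem _ h⟩
    have h1 := M.smul_mem (η : 𝓞 K) h
    rwa [smul_smul, Units.mul_inv, one_smul] at h1
  refine properClass_lattice_eq_iff.2 ⟨DistribMulAction.toModuleAut K V (a * ηE * a'⁻¹), ?_, ?_⟩
  · refine mem_properOrthogonalGroup_of_isProperEnd hdim (hE _) ?_
    change LinearMap.det (Algebra.lsmul K K V ((a * ηE * a'⁻¹ : Eˣ) : E)) = 1
    have h0 : algebraMap (𝓞 K) K ε' ≠ 0 := by simp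
    apply mul_right_cancel₀ h0
    rw [one_mul, ← hε', ← hdet, ← Units.val_mul,
      show a * ηE * a'⁻¹ * (a' * a₁⁻¹) = a * a₁⁻¹ * ηE by group; exact mul_right_comm _ _ _,
      Units.val_mul, hdet, hε, hηdet, hε', ← hη]
    simp
  · rw [smul_smul, ← map_mul, inv_mul_cancel_right, map_mul, mul_smul, hηN]

theorem finite_properClasses_zero (hdim : Module.finrank K V = 2) (hsymm : B.IsSymm) (hB : B ≠ 0)
    (hL : IsLattice K L) (hrank : Module.finrank E V = 1)
    (hE : ∀ z : E, IsProperEnd B (Algebra.lsmul K K V z)) : (properClasses B L 0).Finite := by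
  obtain ⟨d, hd, hdL⟩ := exists_forall_smul_smul_mem (E := E) hdim hsymm hB hL hE
  have hD : ∀ M ∈ genusLattices B L, M.FG ∧ M ≠ ⊥ := by
    rintro M ⟨ρ, hρ⟩
    refine ⟨hρ.isLattice.1, ?_⟩
    rintro rfl
    have := hρ.isLattice.2
    rw [Submodule.bot_coe, Submodule.span_zero_singleton] at this
    have : Subsingleton V := (Submodule.subsingleton_iff K).1 (subsingleton_of_bot_eq_top this)
    rw [Module.finrank_zero_of_subsingleton] at hdim
    exact absurd hdim (by norm_num)
  obtain ⟨T, hT, hTL⟩ := exists_finite_forall_exists_smul_mem hrank hD hd hdL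
  refine (hT.biUnion fun N _ => finite_image_properClass_of_smul (L := L) hdim hE N).subset ?_
  rintro _ ⟨Y, hY, rfl⟩
  obtain ⟨M, hM, rfl, h⟩ := (mem_properGenus_zero_iff hL).1 hY
  choose ρ hρ hρM using h
  have hMg : M ∈ genusLattices B L := ⟨ρ, hM, hρ, hρM⟩
  obtain ⟨a, N, hN, rfl⟩ := hTL M hMg
  exact Set.mem_biUnion hN ⟨a, hMg, rfl⟩

end Finiteness
-- The square root of -det acting on the plane.
section SkewEndomorphism

variable {K V : Type*} [Field K] [AddCommGroup V] [Module K V]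

lemma exists_isProperEnd_sq_eq (B : LinearMap.BilinForm K V) (hsymm : B.IsSymm)
    (b : Module.Basis (Fin 2) K V) : ∃ T : Module.End K V,
      T * T = (-(LinearMap.BilinForm.toMatrix b B).det) • 1 ∧ LinearMap.trace K V T = 0 ∧
        IsProperEnd B T := by
  have hs : ∀ x y, B x y = B y x := hsymm.eq
  -- This is the Gram matrix multiplied on the left by the quarter turn (0, -1; 1, 0). It makes
  -- B(Tx, y) alternating, so T is skew of trace 0 and T² = -det.
  let M : Matrix (Fin 2) (Fin 2) K :=
    !![-B (b 0) (b 1), -B (b 1) (b 1); B (b 0) (b 0), B (b 0) (b 1)]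
  let T : Module.End K V := Matrix.toLin b b M
  have htr : LinearMap.trace K V T = 0 := by
    rw [LinearMap.trace_eq_matrix_trace K b, LinearMap.toMatrix_toLin, Matrix.trace_fin_two]
    simp [M]
  have hT : ∀ j, T (b j) = M 0 j • b 0 + M 1 j • b 1 := fun j => by
    rw [Matrix.toLin_self, Fin.sum_univ_two]
  refine ⟨T, ?_, htr, ?_⟩
  · apply b.ext
    intro i
    rw [Module.End.mul_apply, hT, map_add, map_smul, map_smul, hT, hT, Matrix.det_fin_two]
    simp only [LinearMap.BilinForm.toMatrix_apply, LinearMap.smul_apply, Module.End.one_apply,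
      hs (b 1) (b 0)]
    fin_cases i <;> simp [M] <;> module
  · have h : B.comp T LinearMap.id = -B.comp LinearMap.id T := by
      apply b.ext
      intro i
      apply b.ext
      intro j
      simp only [LinearMap.BilinForm.comp_apply, LinearMap.neg_apply, LinearMap.id_apply, hT,
        map_add, map_smul, LinearMap.add_apply, LinearMap.smul_apply, smul_eq_mul]
      fin_cases i <;> fin_cases j <;> simp [M, hs (b 1) (b 0)] <;> ring
    intro x y
    rw [htr, zero_smul, zero_sub, map_neg]
    exact LinearMap.congr_fun₂ h x y

lemma isProperEnd_smul_one_add_smul (hdim : Module.finrank K V = 2) {B : LinearMap.BilinForm K V}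
    {T : Module.End K V} (htr : LinearMap.trace K V T = 0) (hT : IsProperEnd B T) (x y : K) :
    IsProperEnd B (x • 1 + y • T) := by
  have : Module.Finite K V := Module.finite_of_finrank_eq_succ hdim
  intro v w
  have h := hT v w
  rw [htr, zero_smul, zero_sub, map_neg] at h
  simp only [map_add, map_smul, htr, LinearMap.trace_one, hdim, LinearMap.add_apply,
    LinearMap.smul_apply, Module.End.one_apply, h, smul_eq_mul, map_sub]
  push_cast
  ring

end SkewEndomorphism

/-! ### Assembling finiteness and the class number formula. -/

section Main

variable {K V : Type*} [Field K] [NumberField K] [AddCommGroup V] [Module K V] [Module (𝓞 K) V]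
  [IsScalarTower (𝓞 K) K V]

lemma finite_properClasses_zero_of_det_ne {B : LinearMap.BilinForm K V} (hsymm : B.IsSymm)
    (hB : B ≠ 0) (hdim : Module.finrank K V = 2) (b : Module.Basis (Fin 2) K V)
    (hdet : ∀ c : K, c ^ 2 ≠ -(LinearMap.BilinForm.toMatrix b B).det)
    {L : Submodule (𝓞 K) V} (hL : IsLattice K L) : (properClasses B L 0).Finite := by
  have : Module.Finite K V := Module.finite_of_finrank_eq_succ hdim
  obtain ⟨T, hT2, htr, hT⟩ := exists_isProperEnd_sq_eq B hsymm b
  let δ : K := -(LinearMap.BilinForm.toMatrix b B).det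
  let E := QuadraticAlgebra K δ 0
  have : Fact (∀ r : K, r ^ 2 ≠ δ + 0 * r) := ⟨fun r h => hdet r (by simpa using h)⟩
  -- E is a field since -det is not a square; sending √-det to T makes V a line over E.
  let φ : E →ₐ[K] Module.End K V := QuadraticAlgebra.lift ⟨T, by rw [hT2, zero_smul, add_zero]⟩
  have : FiniteDimensional ℚ E := Module.Finite.trans K E
  have : NumberField E := ⟨⟩
  let _ : Module E V := Module.compHom V φ.toRingHom
  let _ : Module (𝓞 E) V := Module.compHom V (algebraMap (𝓞 E) E)
  have hsmul : ∀ (z : E) (v : V), z • v = φ z v := fun _ _ => rfl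
  have : IsScalarTower K E V := ⟨fun c z v => by rw [hsmul, hsmul, map_smul]; rfl⟩
  have : IsScalarTower (𝓞 E) E V := ⟨fun c z v => by
    rw [Algebra.smul_def, mul_smul]; rfl⟩
  have hrank : Module.finrank E V = 1 := by
    have h := Module.finrank_mul_finrank K E V
    rw [hdim, QuadraticAlgebra.finrank_eq_two] at h
    omega
  refine finite_properClasses_zero (E := E) hdim hsymm hB hL hrank fun z => ?_
  have hz : (Algebra.lsmul K K V z : Module.End K V) = z.re • 1 + z.im • T := by
    ext v
    change algebraMap K (Module.End K V) z.re v + z.im • T v = _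
    simp [Module.algebraMap_end_apply]
  rw [hz]
  exact isProperEnd_smul_one_add_smul hdim htr hT _ _

end Main
end ShiftedLattice

open ShiftedLattice

theorem mainTheorem8 {K V : Type*} [Field K] [NumberField K] [AddCommGroup V] [Module K V]
    [Module (𝓞 K) V] [IsScalarTower (𝓞 K) K V]
    (B : LinearMap.BilinForm K V) (hsymm : B.IsSymm) (hnd : B.Nondegenerate)
    (hdim : Module.finrank K V = 2)
    (hdet : ∀ (b : Module.Basis (Fin 2) K V) (c : Kˣ),
      (LinearMap.BilinForm.toMatrix b B).det ≠ -(c : K) ^ 2)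
    (L : Submodule (𝓞 K) V) (hL : ShiftedLattice.IsLattice K L) (ν : V) :
    (ShiftedLattice.properClasses B L ν).Finite ∧
    (ShiftedLattice.properClasses B L 0).Finite ∧
    ShiftedLattice.properStabilizer B (ShiftedLattice.shift L ν) ≤
      ShiftedLattice.properStabilizer B (L : Set V) ∧
    ShiftedLattice.globalIndex B L ν ≠ 0 ∧
    (∀ p : HeightOneSpectrum (𝓞 K),
      ShiftedLattice.properStabilizer (B.baseChange (p.adicCompletion K))
          (ShiftedLattice.finiteLocalization p L ν) ≤
        ShiftedLattice.properStabilizer (B.baseChange (p.adicCompletion K))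
          (ShiftedLattice.finiteLocalization p L 0) ∧
      ShiftedLattice.localIndex B L ν p ≠ 0) ∧
    {p : HeightOneSpectrum (𝓞 K) | p.asIdeal ∣ ShiftedLattice.conductor L ν}.Finite ∧
    (ShiftedLattice.properClassNumber B L ν : ℚ) =
      (ShiftedLattice.properClassNumber B L 0 : ℚ) / (ShiftedLattice.globalIndex B L ν : ℚ) *
        ∏ᶠ p ∈ {p : HeightOneSpectrum (𝓞 K) | p.asIdeal ∣ ShiftedLattice.conductor L ν},
          (ShiftedLattice.localIndex B L ν p : ℚ) := by
  have : Module.Finite K V := Module.finite_of_finrank_eq_succ hdim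
  let b := Module.finBasisOfFinrankEq K V hdim
  have hdet0 : (LinearMap.BilinForm.toMatrix b B).det ≠ 0 :=
    LinearMap.BilinForm.nondegenerate_iff_det_ne_zero b |>.1 hnd
  have hB : B ≠ 0 := by
    rintro rfl
    apply hdet0
    rw [map_zero, Matrix.det_zero]
  have hfin0 : (properClasses B L 0).Finite := by
    refine finite_properClasses_zero_of_det_ne hsymm hB hdim b (fun c hc => ?_) hL
    rcases eq_or_ne c 0 with rfl | hc0
    · exact hdet0 (by simpa using hc.symm)
    · exact hdet b (Units.mk0 c hc0) (by rw [Units.val_mk0, hc, neg_neg])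
  have hprod := globalIndex_mul_index_classSubgroup hdim hsymm hB hL ν
  have hlocal := fun p => localIndex_ne_zero (B := B) hL ν p
  have hne : globalIndex B L ν * (classSubgroup hdim B hL ν).index ≠ 0 := by
    rw [hprod]
    exact Finset.prod_ne_zero_iff.2 fun p _ => hlocal p
  have hcard := natCard_properClasses hdim hsymm hB hL ν
  have hfin : (properClasses B L ν).Finite := by
    -- Infinite sets have `ncard` 0, so the product formula gives finiteness: h⁺(L) > 0 because L is
    -- in its own genus, and the index is a factor of a nonzero product.
    apply Set.finite_of_ncard_ne_zero
    have : Nat.card (properClasses B L 0) ≠ 0 := by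
      have hL0 : (L : Set V) ∈ properGenus B L 0 :=
        (mem_properGenus_zero_iff hL).2 ⟨L, hL, rfl, fun p => ⟨1, one_mem _, one_smul _ _⟩⟩
      rw [Nat.card_coe_set_eq]
      exact (Set.ncard_pos hfin0).2 ⟨_, _, hL0, rfl⟩ |>.ne'
    rw [← Nat.card_coe_set_eq, hcard]
    exact mul_ne_zero this (right_ne_zero_of_mul hne)
  refine ⟨hfin, hfin0, fun g hg => (mem_properStabilizer_shift.1 hg).1, left_ne_zero_of_mul hne,
    fun p => ⟨fun σ hσ => ?_, hlocal p⟩, finite_setOf_dvd_conductor hL ν, ?_⟩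
  · have h := mem_properStabilizer_finiteLocalization.1 hσ
    exact mem_properStabilizer_finiteLocalization.2 ⟨h.1, h.2.1, by simp⟩
  · have h1 : ∏ᶠ p ∈ {p : HeightOneSpectrum (𝓞 K) | p.asIdeal ∣ conductor L ν},
        (localIndex B L ν p : ℚ) = globalIndex B L ν * (classSubgroup hdim B hL ν).index := by
      rw [finprod_mem_eq_finite_toFinset_prod _ (finite_setOf_dvd_conductor hL ν)]
      exact_mod_cast hprod.symm
    have h2 : (globalIndex B L ν : ℚ) ≠ 0 := by exact_mod_cast left_ne_zero_of_mul hne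
    rw [h1, properClassNumber, properClassNumber, ← Nat.card_coe_set_eq, ← Nat.card_coe_set_eq,
      hcard]
    push_cast
    field_simp
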